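/- Let $0<\alpha<\beta$, $\rho=\alpha/\beta$, and let $L\ge1$ be an integer. For a positive sequence $w=(w(k))_{k\ge1}$ let $L_2(w)$ be the Hilbert space of real sequences $x=(x(k))_{k\ge0}$ with $x(0)=0$ and $\|x\|_{L_2(w)}^2=\sum_{k\ge1}x(k)^2/w(k)<\infty$. Let $$\mathcal K x(k)=\beta L\rho^{L^{k-1}}x(k-1)-(\beta L\rho^{L^k}+\beta)x(k)+\beta x(k+1),\quad k\ge1,\qquad \mathcal Kx(0)=0 .$$ Put $\tilde u(k)=\rho^{1+L+\cdots+L^{k-1}}$, $\pi(k)=L^{k-1}\rho^{L+L^2+\cdots+L^{k-1}}$ and $g_\theta(k)=\theta^k$. Let $B=(B(k))_{k\ge0}$ be a sequence of independent centered Brownian motions with $B(0)=0$ and $\operatorname{var}B_1(k)=2\beta(\tilde u(k)-\tilde u(k+1))$ for $k\ge1$, and consider the SDE $$Z_t=Z_0+\int_0^t\mathcal K Z_s\,ds+B_t,\qquad t\ge0. \tag{1}$$ Let $Q_0=0$, $Q_1=1$ and $-xQ_n(x)=\beta Q_{n-1}(x)-(\beta L\rho^{L^n}+\beta)Q_n(x)+\beta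 L\rho^{L^n}Q_{n+1}(x)$ for $n\ge1$. There are a probability measure $\psi$ on $[0,\infty)$ with $\int Q_iQ_j\,d\psi=\pi(i)^{-1}1_{i=j}$ for $i,j\ge1$, and a sub-stochastic transition function $P_t=(p_t(i,j))_{i,j\ge1}$ of the birth and death process on $\{1,2,\dots\}$ with birth rates $\beta L\rho^{L^k}$ and death rates $\beta$ (killed at rate $\beta$ in state $1$), such that $$p_t(j,i)=\pi(i)\int_0^\infty e^{-xt}Q_i(x)Q_j(x)\,\psi(dx),\qquad i,j\ge1,\ t\ge0, \tag{2}$$ and the following holds. Let $w$ be a positive sequence for which there are $c,d>0$ with $$c\,w(k+1)\le w(k)\le d\,\rho^{-2L^k}w(k+1),\qquad k\ge1. \tag{3}$$ (a) $\mathcal K$ is a bounded operator on $L_2(w)$; for each $z_0\in L_2(w)$ the equation $\dot z_t=\mathcal Kz_t$, $t\ge 0$, has in $L_2(w)$ the unique solution $z_t=e^{\mathcal Kt}z_0$ starting at $z_0$; the matrix of $e^{\mathcal Kt}$ is the transpose of $P_t$, hence is given by (2), that is, $(e^{\mathcal Kt}x)(i)=\sum_{j\ge1}p_t(j,i)x(j)$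 for $x\in L_2(w)$, $i\ge1$, $t\ge0$; and pathwise uniqueness holds for solutions of (1) in $L_2(w)$. (b) If in addition $\tilde u\in\ell_1(w)$, that is $\sum_{k\ge1}\tilde u(k)/w(k)<\infty$, then $B$ is a.s. a continuous process in $L_2(w)$, and for every $L_2(w)$-valued random variable $Z_0$ the SDE (1) has in $L_2(w)$ a unique solution starting at $Z_0$. It has a.s. continuous paths, $Z_t$ is a.s. equal to a function of $Z_0$ and $(B_s)_{s\le t}$ that is measurable for the $\sigma$-algebra they generate, and for each $t\ge0$, a.s., $$Z_t=e^{\mathcal Kt}Z_0+\int_0^te^{\mathcal K(t-s)}\,dB_s ,$$ $$Z_t(i)=\sum_{j\ge1}\pi(i)\int e^{-xt}Q_i(x)Q_j(x)\Bigl(Z_0(j)+\int_0^te^{xs}\,dB_s(j)\Bigr)\psi(dx),\qquad i\ge1,$$ where the stochastic integrals $\int_0^te^{xs}\,dB_s(j)$ are taken in a version that is continuous in $x$. Condition (3) holds for $w=\pi$ and for $w=g_\theta$ for every $\theta>0$. Moreover $\tilde u\in\ell_1(w)$ for $w=\pi$ and for $w=g_\theta$, $\theta>0$, when $L\ge2$,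 and for $w=g_\theta$, $\theta>\rho$, when $L=1$. -/

import Mathlib

open MeasureTheory ProbabilityTheory Filter Topology Polynomial
open scoped NNReal ENNReal

noncomputable section

namespace EquilibriumOU

/-! ### The weighted sequence spaces -/

/-- A weight: a sequence `(w(k))_{k ≥ 1}` of positive reals (the value at `0` plays no role). -/
structure Weight where
  toFun : ℕ → ℝ
  pos : ∀ k, 1 ≤ k → 0 < toFun k

instance : CoeFun Weight (fun _ => ℕ → ℝ) := ⟨Weight.toFun⟩

theorem L2_summable_add (w : Weight) {x y : ℕ → ℝ}
    (hx : Summable fun k => x (k + 1) ^ 2 / w (k + 1))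
    (hy : Summable fun k => y (k + 1) ^ 2 / w (k + 1)) :
    Summable fun k => (x (k + 1) + y (k + 1)) ^ 2 / w (k + 1) := by
  refine Summable.of_nonneg_of_le (fun k => ?_) (fun k => ?_) ((hx.add hy).mul_left 2)
  · exact div_nonneg (sq_nonneg _) (w.pos _ (by omega)).le
  · rw [← add_div, ← mul_div_assoc]
    refine div_le_div_of_nonneg_right ?_ (w.pos _ (by omega)).le
    nlinarith [sq_nonneg (x (k + 1) - y (k + 1))]

/-- Real sequences with `x(0) = 0` and `∑_{k ≥ 1} x(k)² / w(k) < ∞`, as a vector space. -/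
def L2Submodule (w : Weight) : Submodule ℝ (ℕ → ℝ) where
  carrier := {x | x 0 = 0 ∧ Summable fun k => x (k + 1) ^ 2 / w (k + 1)}
  add_mem' := by
    rintro x y ⟨hx0, hx⟩ ⟨hy0, hy⟩
    exact ⟨by simp [hx0, hy0], L2_summable_add w hx hy⟩
  zero_mem' := ⟨rfl, by simp⟩
  smul_mem' := by
    rintro a x ⟨hx0, hx⟩
    refine ⟨by simp [hx0], ?_⟩
    have := hx.mul_left (a ^ 2)
    refine this.congr (fun k => ?_)
    simp [mul_pow, mul_div_assoc]

/-- The Hilbert space `L₂(w)`. It is a type of its own, so that its topology is the one of its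
norm (and not the topology of pointwise convergence). -/
def L2 (w : Weight) : Type := L2Submodule w

namespace L2

variable {w : Weight}

instance (priority := 50) : AddCommGroup (L2 w) := inferInstanceAs (AddCommGroup (L2Submodule w))

instance (priority := 50) : Module ℝ (L2 w) := inferInstanceAs (Module ℝ (L2Submodule w))

instance : CoeFun (L2 w) (fun _ => ℕ → ℝ) := ⟨fun x => x.1⟩

/-- The isomorphism `x ↦ (x(k) / √w(k))_{k ≥ 1}` of `L₂(w)` with the unweighted `ℓ²`. -/
def toEll2 (w : Weight) : L2 w →ₗ[ℝ] lp (fun _ : ℕ => ℝ) 2 where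
  toFun x := ⟨fun k => x (k + 1) / √(w (k + 1)), by
    refine memℓp_gen ?_
    refine x.2.2.congr (fun k => ?_)
    have := (w.pos (k + 1) (by omega)).le
    simp [div_pow, Real.sq_sqrt this]⟩
  map_add' x y := by
    ext k
    exact add_div (x (k + 1)) (y (k + 1)) _
  map_smul' a x := by
    ext k
    exact mul_div_assoc a (x (k + 1)) _

theorem toEll2_apply (x : L2 w) (k : ℕ) : toEll2 w x k = x (k + 1) / √(w (k + 1)) := rfl

theorem sqrt_pos (w : Weight) (k : ℕ) : 0 < √(w (k + 1)) :=
  Real.sqrt_pos.2 (w.pos (k + 1) (by omega))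

theorem toEll2_injective (w : Weight) : Function.Injective (toEll2 w) := by
  intro x y h
  refine Subtype.ext (funext fun k => ?_)
  rcases k with _ | k
  · exact x.2.1.trans y.2.1.symm
  · have h1 : toEll2 w x k = toEll2 w y k := by rw [h]
    rw [toEll2_apply, toEll2_apply] at h1
    exact (div_left_inj' (sqrt_pos w k).ne').1 h1

theorem toEll2_surjective (w : Weight) : Function.Surjective (toEll2 w) := by
  intro y
  refine ⟨⟨fun k => match k with | 0 => 0 | k + 1 => y k * √(w (k + 1)), rfl, ?_⟩, ?_⟩
  · have hy := (memℓp_gen_iff (by norm_num)).1 (lp.memℓp y)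
    refine hy.congr (fun k => ?_)
    have h := (w.pos (k + 1) (by omega))
    simp [mul_pow, Real.sq_sqrt h.le, h.ne']
  · ext k
    exact mul_div_cancel_right₀ (y k) (sqrt_pos w k).ne'

instance : NormedAddCommGroup (L2 w) :=
  NormedAddCommGroup.induced (L2 w) (lp (fun _ : ℕ => ℝ) 2) (toEll2 w) (toEll2_injective w)

instance : InnerProductSpace ℝ (L2 w) where
  norm_smul_le a x := by
    change ‖toEll2 w (a • x)‖ ≤ ‖a‖ * ‖toEll2 w x‖
    rw [map_smul]
    exact norm_smul_le a _
  inner x y := inner ℝ (toEll2 w x) (toEll2 w y)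
  norm_sq_eq_re_inner x := norm_sq_eq_re_inner (𝕜 := ℝ) (toEll2 w x)
  conj_inner_symm x y := inner_conj_symm (toEll2 w x) (toEll2 w y)
  add_left x y z := by
    change inner ℝ (toEll2 w (x + y)) (toEll2 w z) = _
    rw [map_add]
    exact inner_add_left _ _ _
  smul_left x y a := by
    change inner ℝ (toEll2 w (a • x)) (toEll2 w y) = _
    rw [map_smul]
    exact inner_smul_left _ _ _

/-- `L₂(w)` is isometrically isomorphic to `ℓ²`. -/
def isometryEquiv (w : Weight) : L2 w ≃ₗᵢ[ℝ] lp (fun _ : ℕ => ℝ) 2 where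
  toLinearEquiv := LinearEquiv.ofBijective (toEll2 w) ⟨toEll2_injective w, toEll2_surjective w⟩
  norm_map' _ := rfl

instance : CompleteSpace (L2 w) :=
  (isometryEquiv w).isometry.isUniformInducing.completeSpace_congr
    (isometryEquiv w).surjective |>.2 inferInstance

/-- The norm of `L₂(w)` is the weighted one: `‖x‖² = ∑_{k ≥ 1} x(k)² / w(k)`. -/
theorem norm_sq_eq (x : L2 w) : ‖x‖ ^ 2 = ∑' k, x (k + 1) ^ 2 / w (k + 1) := by
  have h1 : ‖x‖ ^ 2 = inner ℝ (toEll2 w x) (toEll2 w x) :=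
    (real_inner_self_eq_norm_sq (toEll2 w x)).symm
  rw [h1, lp.inner_eq_tsum]
  refine tsum_congr (fun k => ?_)
  have h := (w.pos (k + 1) (by omega)).le
  simp only [toEll2_apply, real_inner_self_eq_norm_sq, Real.norm_eq_abs, sq_abs, div_pow,
    Real.sq_sqrt h]

end L2

/-! ### The stable point, the drift operator and the weights of the model -/

/-- The stable point `ũ(k) = ρ^{L^{k-1} + ⋯ + L + 1}`, that is `ρ^{(L^k - 1)/(L - 1)}`. -/
def stablePoint (L : ℕ) (ρ : ℝ) (k : ℕ) : ℝ := ρ ^ (∑ m ∈ Finset.range k, L ^ m)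

/-- The variances `ṽ(k) = 2β(ũ(k) - ũ(k+1))` of the driving Brownian motions at time `1`. -/
def noiseVar (L : ℕ) (β ρ : ℝ) (k : ℕ) : ℝ :=
  2 * β * (stablePoint L ρ k - stablePoint L ρ (k + 1))

/-- The drift `𝒦` acting on sequences with `x(0) = 0`: for `k ≥ 1`,
`𝒦x(k) = βLρ^{L^{k-1}} x(k-1) - (βLρ^{L^k} + β) x(k) + β x(k+1)`, and `𝒦x(0) = 0`. -/
def drift (L : ℕ) (β ρ : ℝ) (x : ℕ → ℝ) : ℕ → ℝ
  | 0 => 0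
  | k + 1 => β * L * ρ ^ (L ^ k) * x k - (β * L * ρ ^ (L ^ (k + 1)) + β) * x (k + 1)
      + β * x (k + 2)

/-- The potential coefficients `π(k) = L^{k-1} ρ^{L^{k-1} + ⋯ + L}`, that is
`L^{k-1} ρ^{(L^k - L)/(L - 1)}`, for `k ≥ 1`. -/
def potential (L : ℕ) (ρ : ℝ) (k : ℕ) : ℝ :=
  (L : ℝ) ^ (k - 1) * ρ ^ (∑ m ∈ Finset.Ico 1 k, L ^ m)

/-- The weight `π`. -/
def potentialWeight (L : ℕ) (ρ : ℝ) (hL : 1 ≤ L) (hρ : 0 < ρ) : Weight where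
  toFun := potential L ρ
  pos k _ := by
    have : (0 : ℝ) < L := by exact_mod_cast hL
    unfold potential
    positivity

/-- The geometric weight `g_θ(k) = θ^k`. -/
def geometricWeight (θ : ℝ) (hθ : 0 < θ) : Weight where
  toFun k := θ ^ k
  pos k _ := pow_pos hθ k

/-- The growth condition on a weight: for some `c, d > 0` and all `k ≥ 1`,
`c w(k+1) ≤ w(k) ≤ d ρ^{-2 L^k} w(k+1)`. -/
def WeightCondition (L : ℕ) (ρ : ℝ) (w : Weight) : Prop :=
  ∃ c d : ℝ, 0 < c ∧ 0 < d ∧ ∀ k, 1 ≤ k →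
    c * w (k + 1) ≤ w k ∧ w k ≤ d * (ρ ^ (2 * L ^ k))⁻¹ * w (k + 1)

/-- `ũ ∈ ℓ₁(w)`, that is `∑_{k ≥ 1} |ũ(k)| / w(k) < ∞`. -/
def StablePointSummable (L : ℕ) (ρ : ℝ) (w : Weight) : Prop :=
  Summable fun k => |stablePoint L ρ (k + 1)| / w (k + 1)

/-! ### The birth and death process -/

/-- The generator `𝒜` of the birth and death process on `{1, 2, …}` with birth rates
`λ_k = βLρ^{L^k}` and death rates `μ_k = β` (the death at state `1` being a killing). -/
def generator (L : ℕ) (β ρ : ℝ) (i j : ℕ+) : ℝ :=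
  if (j : ℕ) = i + 1 then β * L * ρ ^ (L ^ (i : ℕ))
  else if (i : ℕ) = j + 1 then β
  else if i = j then -(β * L * ρ ^ (L ^ (i : ℕ)) + β)
  else 0

/-- `P` is a sub-stochastic transition function `P_t = (p_t(i, j))`, `t ≥ 0`, with generator
matrix `A = P'_0`. (If `A` has bounded diagonal, as in the case above, it determines `P`.) -/
structure IsTransitionFunction {S : Type*} [DecidableEq S] (A : S → S → ℝ)
    (P : ℝ → S → S → ℝ) : Prop where
  nonneg : ∀ t, 0 ≤ t → ∀ i j, 0 ≤ P t i j
  summable : ∀ t, 0 ≤ t → ∀ i, Summable (P t i)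
  sum_le_one : ∀ t, 0 ≤ t → ∀ i, ∑' j, P t i j ≤ 1
  zero : ∀ i j, P 0 i j = if i = j then 1 else 0
  chapman_kolmogorov : ∀ s t, 0 ≤ s → 0 ≤ t → ∀ i j,
    HasSum (fun k => P s i k * P t k j) (P (s + t) i j)
  deriv_zero : ∀ i j, HasDerivWithinAt (fun t => P t i j) (A i j) (Set.Ici 0) 0

/-- The polynomials `Q_n`: `Q_0 = 0`, `Q_1 = 1` and, for `n ≥ 1`,
`λ_n Q_{n+1}(x) = (λ_n + β - x) Q_n(x) - β Q_{n-1}(x)` with `λ_n = βLρ^{L^n}`. -/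
def orthoPoly (L : ℕ) (β ρ : ℝ) : ℕ → ℝ[X]
  | 0 => 0
  | 1 => 1
  | n + 2 => C (β * L * ρ ^ (L ^ (n + 1)))⁻¹ *
      ((C (β * L * ρ ^ (L ^ (n + 1)) + β) - X) * orthoPoly L β ρ (n + 1)
        - C β * orthoPoly L β ρ n)

/-- `ψ` is a spectral measure: a probability measure on `[0, ∞)` for which the `Q_i`, `i ≥ 1`,
are orthogonal with `∫ Q_i² dψ = π(i)⁻¹`. -/
structure IsSpectralMeasure (L : ℕ) (β ρ : ℝ) (ψ : Measure ℝ) : Prop where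
  isProbabilityMeasure : IsProbabilityMeasure ψ
  nonneg : ψ (Set.Iio 0) = 0
  integrable : ∀ i j, 1 ≤ i → 1 ≤ j →
    Integrable (fun x => (orthoPoly L β ρ i).eval x * (orthoPoly L β ρ j).eval x) ψ
  orthogonal : ∀ i j, 1 ≤ i → 1 ≤ j →
    ∫ x, (orthoPoly L β ρ i).eval x * (orthoPoly L β ρ j).eval x ∂ψ
      = if i = j then (potential L ρ i)⁻¹ else 0

/-! ### The driving noise, the SDE and stochastic integrals -/

section Stochastic

variable {Ω : Type*} [MeasurableSpace Ω]

/-- `B = (B(k))_{k ∈ ℕ}` is a sequence of independent centered Brownian motions with `B(0) = 0`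
and `var B_1(k) = ṽ(k)` for `k ≥ 1`; `B k t` is the value `B_t(k)`. -/
structure IsDrivingNoise (L : ℕ) (β ρ : ℝ) (μ : Measure Ω) (B : ℕ → ℝ≥0 → Ω → ℝ) : Prop where
  zero : ∀ t ω, B 0 t ω = 0
  brownian : ∀ k, 1 ≤ k → IsBrownianReal (fun t ω => B k t ω / √(noiseVar L β ρ k)) μ
  indep : iIndepFun (fun k ω t => B k t ω) μ

/-- `Z` solves `Z_t = Z_0 + ∫_0^t 𝒦 Z_s ds + B_t`, `t ≥ 0`, in `L₂(w)`: each `Z_t` is a random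
variable in `L₂(w)`, almost surely the path of `Z` is locally (Bochner) integrable in `L₂(w)`, and
the equation holds for all times, in each coordinate (`B` itself may fail to be in `L₂(w)`). -/
structure IsSDESolution (L : ℕ) (β ρ : ℝ) {w : Weight} (μ : Measure Ω) (B : ℕ → ℝ≥0 → Ω → ℝ)
    (Z : ℝ≥0 → Ω → L2 w) : Prop where
  aestronglyMeasurable : ∀ t, AEStronglyMeasurable (Z t) μ
  integrable : ∀ᵐ ω ∂μ, ∀ T : ℝ≥0,
    IntervalIntegrable (fun s : ℝ => Z s.toNNReal ω) volume 0 T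
  equation : ∀ᵐ ω ∂μ, ∀ (t : ℝ≥0) (k : ℕ), 1 ≤ k →
    Z t ω k = Z 0 ω k + (∫ s in (0 : ℝ)..t, drift L β ρ (Z s.toNNReal ω) k) + B k t ω

/-- The σ-algebra generated by the initial value and by the noise up to time `t`. -/
@[reducible] def noiseSigma {w : Weight} (Z₀ : Ω → L2 w) (B : ℕ → ℝ≥0 → Ω → ℝ) (t : ℝ≥0) :
    MeasurableSpace Ω :=
  (⨆ k : ℕ, MeasurableSpace.comap (fun ω => Z₀ ω k) (borel ℝ)) ⊔
    ⨆ (k : ℕ) (s : ℝ≥0) (_ : s ≤ t), MeasurableSpace.comap (B k s) (borel ℝ)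

/-- `I = ∫_0^t Φ(s) dW_s` for a deterministic, continuous, operator-valued `Φ` and a process `W`:
for all sequences `0 = τ_n(0) ≤ τ_n(1) ≤ ⋯ ≤ τ_n(N_n) = t` of subdivisions with mesh tending to
`0`, the sums `∑_i Φ(τ_n(i)) (W_{τ_n(i+1)} - W_{τ_n(i)})` converge to `I` in probability. -/
def IsStochasticIntegral {E F : Type*} [NormedAddCommGroup E] [NormedSpace ℝ E]
    [NormedAddCommGroup F] [NormedSpace ℝ F] (μ : Measure Ω) (Φ : ℝ≥0 → E →L[ℝ] F)
    (W : ℝ≥0 → Ω → E) (t : ℝ≥0) (I : Ω → F) : Prop :=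
  ∀ (N : ℕ → ℕ) (τ : ℕ → ℕ → ℝ≥0),
    (∀ n, Monotone (τ n)) → (∀ n, τ n 0 = 0) → (∀ n, τ n (N n) = t) →
    (∀ ε : ℝ, 0 < ε → ∀ᶠ n in atTop, ∀ i < N n, (τ n (i + 1) : ℝ) - τ n i < ε) →
    TendstoInMeasure μ
      (fun n ω => ∑ i ∈ Finset.range (N n), Φ (τ n i) (W (τ n (i + 1)) ω - W (τ n i) ω)) atTop I

end Stochastic

end EquilibriumOU

end

open EquilibriumOU

/-! The growth condition on `w` is what bounds the three bands of the drift: `c` controls the term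
`x(k+1)`, while the factor `ρ^(L^(k-1))` in front of `x(k-1)` absorbs the growth of the weight
allowed by `d` (`sq_drift_div_le`). Once `𝒦` is bounded, `e^{t𝒦}` is a norm-convergent series,
uniqueness is the integrating factor `e^{-t𝒦}`, and the matrix entries of `e^{t𝒦}` are scalar series
that do not involve `w`. Hence a single matrix `transition` serves every weight. It is nonnegative
and sub-stochastic by uniformization: adding the constant `βL + β` to the drift makes it positive,
with mass growth at most that constant (`transition_nonneg_and_sum_le`).

The negative generator, symmetrized by `√π`, is a bounded Jacobi operator `J = S* S` on `ℓ²`. The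
spectral measure `ψ` is the distribution of `J` in the first unit vector `e_0`; it has bounded
support in `[0, ∞)`. The recurrence gives `Q_{n+1}(J) e_0 = c_n e_n` with `c_n² = 1/π(n+1)`, which
is orthogonality (`exists_spectralMeasure`). Powers of `𝒦` become moments of `ψ`, and summing the
exponential series gives the integral formula for the transition probabilities
(`exp_pow_single_apply`).

The stochastic part is pathwise. The integrands are deterministic and smooth in time, so each
stochastic integral is a Riemann–Stieltjes integral, computed by partial integration along
continuous paths (`tendsto_sum_apply_increment`). What probability must supply is continuity of `B`
in `L₂(w)`: a chaining bound from fourth moments, uniform over the coordinates, is summed against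
`var B_1(k) / w(k)` (`exists_noise_path`). The variation of constants formula then solves the
equation, the difference of two solutions solves the homogeneous one, and expansion in unit vectors
yields the spectral form (`hasSum_spectral_mildSolution`). -/

noncomputable section

namespace EquilibriumOU

/-! ### Coordinates and unit vectors of `L₂(w)` -/

namespace L2

variable {w : Weight}

theorem ext {x y : L2 w} (h : ∀ k : ℕ+, x k = y k) : x = y := by
  refine Subtype.ext (funext fun k => ?_)
  rcases k with _ | k
  · exact x.2.1.trans y.2.1.symm
  · exact h ⟨k + 1, k.succ_pos⟩

theorem add_apply (x y : L2 w) (k : ℕ) : (x + y) k = x k + y k := rfl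

theorem smul_apply (a : ℝ) (x : L2 w) (k : ℕ) : (a • x) k = a * x k := rfl

theorem sub_apply (x y : L2 w) (k : ℕ) : (x - y) k = x k - y k := rfl

theorem hasSum_norm_sq (x : L2 w) :
    HasSum (fun k => x (k + 1) ^ 2 / w (k + 1)) (‖x‖ ^ 2) := by
  rw [norm_sq_eq]
  exact x.2.2.hasSum

theorem abs_apply_le (x : L2 w) (k : ℕ) : |x (k + 1)| ≤ √(w (k + 1)) * ‖x‖ := by
  have h := lp.norm_apply_le_norm (by norm_num) (toEll2 w x) k
  rw [toEll2_apply, Real.norm_eq_abs, abs_div, abs_of_pos (sqrt_pos w k),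
    div_le_iff₀ (sqrt_pos w k)] at h
  rw [mul_comm]
  exact h

/-- The coordinate functionals. -/
def coord (w : Weight) : ℕ → L2 w →L[ℝ] ℝ
  | 0 => 0
  | k + 1 => LinearMap.mkContinuous
      { toFun := fun x => x (k + 1), map_add' := fun _ _ => rfl, map_smul' := fun _ _ => rfl }
      (√(w (k + 1))) (fun x => abs_apply_le x k)

theorem coord_apply (x : L2 w) (k : ℕ) : coord w k x = x k := by
  cases k with
  | zero => exact x.2.1.symm
  | succ k => rfl

/-- The unit vectors. -/
def single (w : Weight) (j : ℕ+) : L2 w :=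
  ⟨Pi.single (j : ℕ) 1, by simp [j.ne_zero.symm], by
    refine summable_of_ne_finset_zero (s := Finset.range j) (fun k hk => ?_)
    have : k + 1 ≠ (j : ℕ) := by
      simp at hk
      omega
    simp [this]⟩

theorem single_coe (j : ℕ+) : ((single w j).1 : ℕ → ℝ) = Pi.single (j : ℕ) 1 := rfl

/-- The series converges in norm, by transport from `ℓ²`. This is why a bounded operator on `L₂(w)`
is determined by its matrix. -/
theorem hasSum_single (x : L2 w) : HasSum (fun j : ℕ+ => x j • single w j) x := by
  rw [← (isometryEquiv w).toHomeomorph.isInducing.hasSum_iff (g := isometryEquiv w)]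
  rw [← Equiv.pnatEquivNat.symm.hasSum_iff]
  convert lp.hasSum_single (by norm_num) (isometryEquiv w x) using 1
  ext k n
  change (x (k + 1) • single w (Nat.succPNat k)) (n + 1) / √(w (n + 1)) = _
  rw [smul_apply, single_coe, lp.single_apply]
  by_cases h : n = k
  · subst h
    simp
    rfl
  · have : n + 1 ≠ ((Nat.succPNat k : ℕ+) : ℕ) := by
      simpa using h
    simp [h]

theorem hasSum_apply (x : L2 w) (T : L2 w →L[ℝ] L2 w) (i : ℕ) :
    HasSum (fun j : ℕ+ => T (single w j) i * x j) (T x i) := by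
  have h := (coord w i ∘L T).hasSum (hasSum_single x)
  simpa [coord_apply, mul_comm] using h

end L2

/-! ### The drift operator -/

theorem drift_add (L : ℕ) (β ρ : ℝ) (x y : ℕ → ℝ) (k : ℕ) :
    drift L β ρ (x + y) k = drift L β ρ x k + drift L β ρ y k := by
  cases k with
  | zero => simp [drift]
  | succ k => simp [drift]; ring

theorem drift_smul (L : ℕ) (β ρ a : ℝ) (x : ℕ → ℝ) (k : ℕ) :
    drift L β ρ (a • x) k = a * drift L β ρ x k := by
  cases k with
  | zero => simp [drift]
  | succ k => simp [drift]; ring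

/-- The three bands are estimated separately. The square of `ρ^(L^k)` cancels exactly the factor
`ρ^(-2 L^k)` of the growth condition. The recursor encodes the shifted sequence, with value `0` at
the first index because `x(0) = 0`; no bound on `w(0)` is then needed. -/
theorem sq_drift_div_le {L : ℕ} {β ρ c d : ℝ} (hρ0 : 0 < ρ) (hρ1 : ρ < 1) (hβ : 0 < β) (hc : 0 < c)
    (w : Weight) (h : ∀ k, 1 ≤ k →
      c * w (k + 1) ≤ w k ∧ w k ≤ d * (ρ ^ (2 * L ^ k))⁻¹ * w (k + 1)) (x : ℕ → ℝ) (hx : x 0 = 0)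
    (k : ℕ) :
    drift L β ρ x (k + 1) ^ 2 / w (k + 1) ≤
      3 * ((β * L) ^ 2 * d * (k.rec 0 fun n _ => x (n + 1) ^ 2 / w (n + 1)) +
        (β * L + β) ^ 2 * (x (k + 1) ^ 2 / w (k + 1)) +
        β ^ 2 * c⁻¹ * (x (k + 2) ^ 2 / w (k + 2))) := by
  have hw (n : ℕ) : 0 < w (n + 1) := w.pos _ (by omega)
  have h3 (a b e : ℝ) : (a + b + e) ^ 2 ≤ 3 * (a ^ 2 + b ^ 2 + e ^ 2) := by
    nlinarith [sq_nonneg (a - b), sq_nonneg (a - e), sq_nonneg (b - e)]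
  have hρp (n : ℕ) : 0 < ρ ^ (L ^ n) := pow_pos hρ0 _
  have hb : (β * L * ρ ^ (L ^ (k + 1)) + β) ^ 2 ≤ (β * L + β) ^ 2 := by
    have : ρ ^ (L ^ (k + 1)) ≤ 1 := pow_le_one₀ hρ0.le hρ1.le
    have hL : 0 ≤ β * L := by positivity
    have h4 := hρp (k + 1)
    have h5 : β * L * ρ ^ (L ^ (k + 1)) ≤ β * L := mul_le_of_le_one_right hL this
    gcongr
  have h1 : (β * L * ρ ^ (L ^ k) * x k) ^ 2 / w (k + 1) ≤
      (β * L) ^ 2 * d * (k.rec 0 fun n _ => x (n + 1) ^ 2 / w (n + 1) : ℝ) := by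
    cases k with
    | zero => simp [hx]
    | succ n =>
      have := (h (n + 1) (by omega)).2
      have h5 := hρp (n + 1)
      have h6 := hw (n + 1)
      have h7 := hw n
      simp only [mul_pow]
      rw [div_le_iff₀ h6]
      have h8 : (ρ ^ (L ^ (n + 1))) ^ 2 * w (n + 1) ≤ d * w (n + 1 + 1) := by
        rw [← pow_mul, mul_comm (L ^ (n + 1)) 2]
        calc ρ ^ (2 * L ^ (n + 1)) * w (n + 1)
            ≤ ρ ^ (2 * L ^ (n + 1)) * (d * (ρ ^ (2 * L ^ (n + 1)))⁻¹ * w (n + 1 + 1)) := by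
              gcongr
          _ = _ := by
              have : ρ ^ (2 * L ^ (n + 1)) ≠ 0 := (pow_pos hρ0 _).ne'
              field_simp
      calc β ^ 2 * L ^ 2 * (ρ ^ (L ^ (n + 1))) ^ 2 * x (n + 1) ^ 2
          = β ^ 2 * L ^ 2 * ((ρ ^ (L ^ (n + 1))) ^ 2 * w (n + 1)) * (x (n + 1) ^ 2 / w (n + 1)) := by
            field_simp
        _ ≤ β ^ 2 * L ^ 2 * (d * w (n + 1 + 1)) * (x (n + 1) ^ 2 / w (n + 1)) := by
            gcongr
        _ = _ := by ring
  have h2 : (β * x (k + 2)) ^ 2 / w (k + 1) ≤ β ^ 2 * c⁻¹ * (x (k + 2) ^ 2 / w (k + 2)) := by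
    have h4 := (h (k + 1) (by omega)).1
    have h6 := hw (k + 1)
    rw [div_le_iff₀ (hw k)]
    calc (β * x (k + 2)) ^ 2 = β ^ 2 * c⁻¹ * (x (k + 2) ^ 2 / w (k + 2)) * (c * w (k + 1 + 1)) := by
          field_simp
      _ ≤ _ := by gcongr
  calc drift L β ρ x (k + 1) ^ 2 / w (k + 1)
      ≤ 3 * ((β * L * ρ ^ (L ^ k) * x k) ^ 2 +
          ((β * L * ρ ^ (L ^ (k + 1)) + β) * x (k + 1)) ^ 2 + (β * x (k + 2)) ^ 2) / w (k + 1) := by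
        have := hw k
        gcongr
        rw [drift, ← neg_sq ((β * L * ρ ^ (L ^ (k + 1)) + β) * x (k + 1)), sub_eq_add_neg]
        exact h3 _ _ _
    _ = 3 * ((β * L * ρ ^ (L ^ k) * x k) ^ 2 / w (k + 1) +
          (β * L * ρ ^ (L ^ (k + 1)) + β) ^ 2 * (x (k + 1) ^ 2 / w (k + 1)) +
            (β * x (k + 2)) ^ 2 / w (k + 1)) := by ring
    _ ≤ _ := by
        have := hw k
        gcongr

theorem summable_drift_and_tsum_le {L : ℕ} {β ρ c d : ℝ} (hρ0 : 0 < ρ) (hρ1 : ρ < 1) (hβ : 0 < β)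
    (hc : 0 < c) {w : Weight} (h : ∀ k, 1 ≤ k →
      c * w (k + 1) ≤ w k ∧ w k ≤ d * (ρ ^ (2 * L ^ k))⁻¹ * w (k + 1)) (x : L2 w) :
    (Summable fun k => drift L β ρ x (k + 1) ^ 2 / w (k + 1)) ∧
    ∑' k, drift L β ρ x (k + 1) ^ 2 / w (k + 1) ≤
      3 * ((β * L) ^ 2 * d + (β * L + β) ^ 2 + β ^ 2 * c⁻¹) * ‖x‖ ^ 2 := by
  have hw (n : ℕ) : 0 < w (n + 1) := w.pos _ (by omega)
  set u : ℕ → ℝ := fun k => x (k + 1) ^ 2 / w (k + 1) with hu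
  have hu0 : HasSum u (‖x‖ ^ 2) := L2.hasSum_norm_sq x
  have hv : HasSum (fun k : ℕ => (k.rec 0 fun n _ => u n : ℝ)) (‖x‖ ^ 2) := by
    rw [← hasSum_nat_add_iff' 1]
    simpa using hu0
  have hv' : Summable fun k => u (k + 1) := (summable_nat_add_iff 1).2 hu0.summable
  have hle : ∑' k, u (k + 1) ≤ ‖x‖ ^ 2 := by
    rw [← hu0.tsum_eq, hu0.summable.tsum_eq_zero_add]
    have : 0 ≤ u 0 := div_nonneg (sq_nonneg _) (hw 0).le
    linarith
  have hS := (((hv.mul_left ((β * L) ^ 2 * d)).add (hu0.mul_left ((β * L + β) ^ 2))).add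
    (hv'.hasSum.mul_left (β ^ 2 * c⁻¹))).mul_left 3
  have hle' := sq_drift_div_le (L := L) hρ0 hρ1 hβ hc w h x x.2.1
  have hsum := Summable.of_nonneg_of_le (fun k => div_nonneg (sq_nonneg _) (hw k).le) hle'
    hS.summable
  refine ⟨hsum, (hsum.tsum_le_tsum hle' hS.summable).trans ?_⟩
  rw [hS.tsum_eq]
  have : β ^ 2 * c⁻¹ * ∑' k, u (k + 1) ≤ β ^ 2 * c⁻¹ * ‖x‖ ^ 2 := by gcongr
  linarith

theorem exists_driftOperator {L : ℕ} {β ρ : ℝ} (hρ0 : 0 < ρ) (hρ1 : ρ < 1) (hβ : 0 < β)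
    {w : Weight} (hw : WeightCondition L ρ w) :
    ∃ 𝒦 : L2 w →L[ℝ] L2 w, ∀ (x : L2 w) (k : ℕ), 𝒦 x k = drift L β ρ x k := by
  obtain ⟨c, d, hc, hd, h⟩ := hw
  have key := summable_drift_and_tsum_le (L := L) hρ0 hρ1 hβ hc h
  let T : L2 w →ₗ[ℝ] L2 w :=
    { toFun := fun x => ⟨drift L β ρ x, rfl, (key x).1⟩
      map_add' := fun x y => Subtype.ext (funext (drift_add L β ρ x y))
      map_smul' := fun a x => Subtype.ext (funext (drift_smul L β ρ a x)) }
  refine ⟨T.mkContinuous (√(3 * ((β * L) ^ 2 * d + (β * L + β) ^ 2 + β ^ 2 * c⁻¹)))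
    (fun x => ?_), fun x k => rfl⟩
  refine le_of_sq_le_sq ?_ (by positivity)
  rw [mul_pow, Real.sq_sqrt (by positivity), L2.norm_sq_eq]
  exact (key x).2

/-! ### The weights of interest -/

theorem weightCondition_potential {L : ℕ} {ρ : ℝ} (hL : 1 ≤ L) (hρ0 : 0 < ρ) (hρ1 : ρ < 1) :
    WeightCondition L ρ (potentialWeight L ρ hL hρ0) := by
  have hL' : (1 : ℝ) ≤ L := by exact_mod_cast hL
  have hL0 : (0 : ℝ) < L := by linarith
  -- The ratio `π(k+1)/π(k) = L ρ^(L^k)` is at most `L`, and its inverse is at most `ρ^(-2 L^k)`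
  -- since `ρ^(L^k) ≤ 1 ≤ L`.
  refine ⟨(L : ℝ)⁻¹, 1, by positivity, one_pos, fun k hk => ?_⟩
  have hpos : 0 < potential L ρ k := (potentialWeight L ρ hL hρ0).pos k hk
  have hstep : potential L ρ (k + 1) = L * ρ ^ (L ^ k) * potential L ρ k := by
    obtain ⟨k, rfl⟩ := Nat.exists_eq_add_of_le' hk
    rw [potential, potential, Finset.sum_Ico_succ_top (by omega), pow_add]
    simp only [Nat.add_sub_cancel, pow_succ]
    ring
  have h1 : ρ ^ (L ^ k) ≤ 1 := pow_le_one₀ hρ0.le hρ1.le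
  have h0 : 0 < ρ ^ (L ^ k) := pow_pos hρ0 _
  change (L : ℝ)⁻¹ * potential L ρ (k + 1) ≤ potential L ρ k ∧
    potential L ρ k ≤ 1 * (ρ ^ (2 * L ^ k))⁻¹ * potential L ρ (k + 1)
  rw [hstep, mul_comm 2, pow_mul]
  constructor
  · rw [mul_assoc, inv_mul_cancel_left₀ hL0.ne']
    exact mul_le_of_le_one_left hpos.le h1
  · have : 1 ≤ L / ρ ^ (L ^ k) := by
      rw [le_div_iff₀ h0]
      linarith
    calc potential L ρ k ≤ L / ρ ^ (L ^ k) * potential L ρ k := le_mul_of_one_le_left hpos.le this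
      _ = _ := by field_simp

theorem weightCondition_geometric (L : ℕ) {ρ θ : ℝ} (hρ0 : 0 < ρ) (hρ1 : ρ < 1) (hθ : 0 < θ) :
    WeightCondition L ρ (geometricWeight θ hθ) := by
  refine ⟨θ⁻¹, θ⁻¹, by positivity, by positivity, fun k _ => ?_⟩
  change θ⁻¹ * θ ^ (k + 1) ≤ θ ^ k ∧ θ ^ k ≤ θ⁻¹ * (ρ ^ (2 * L ^ k))⁻¹ * θ ^ (k + 1)
  have h1 : θ⁻¹ * θ ^ (k + 1) = θ ^ k := by
    rw [pow_succ]
    field_simp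
  refine ⟨h1.le, ?_⟩
  rw [mul_right_comm, h1]
  exact le_mul_of_one_le_right (by positivity)
    ((one_le_inv₀ (pow_pos hρ0 _)).2 (pow_le_one₀ hρ0.le hρ1.le))

theorem stablePoint_pos {ρ : ℝ} (L : ℕ) (hρ0 : 0 < ρ) (k : ℕ) : 0 < stablePoint L ρ k :=
  pow_pos hρ0 _

/-- The quotient `ũ(k+1)/π(k+1)` equals `ρ L^(-k)` exactly, so the series is geometric and converges
precisely because `L ≥ 2`. -/
theorem stablePointSummable_potential {L : ℕ} {ρ : ℝ} (hL : 1 ≤ L) (hL2 : 2 ≤ L) (hρ0 : 0 < ρ) :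
    StablePointSummable L ρ (potentialWeight L ρ hL hρ0) := by
  have hL' : (2 : ℝ) ≤ L := by exact_mod_cast hL2
  have h : Summable fun k : ℕ => ρ * (L : ℝ)⁻¹ ^ k :=
    (summable_geometric_of_lt_one (by positivity) (inv_lt_one_of_one_lt₀ (by linarith))).mul_left ρ
  refine h.congr (fun k => ?_)
  change _ = |stablePoint L ρ (k + 1)| / potential L ρ (k + 1)
  rw [abs_of_pos (stablePoint_pos L hρ0 _), stablePoint, potential, Finset.range_eq_Ico,
    Finset.sum_eq_sum_Ico_succ_bot (by omega), pow_zero, pow_add, pow_one, Nat.add_sub_cancel,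
    zero_add, inv_pow]
  have : ρ ^ (∑ m ∈ Finset.Ico 1 (k + 1), L ^ m) ≠ 0 := (pow_pos hρ0 _).ne'
  field_simp

/-- Successive terms have ratio `ρ^(L^(k+1))/θ`, which tends to `0` for every `θ` once `L ≥ 2`. -/
theorem stablePointSummable_geometric {L : ℕ} {ρ θ : ℝ} (hL2 : 2 ≤ L) (hρ0 : 0 < ρ) (hρ1 : ρ < 1)
    (hθ : 0 < θ) : StablePointSummable L ρ (geometricWeight θ hθ) := by
  refine summable_of_ratio_test_tendsto_lt_one (l := 0) zero_lt_one
    (Eventually.of_forall fun k => ?_) ?_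
  · have := stablePoint_pos L hρ0 (k + 1)
    have := (geometricWeight θ hθ).pos (k + 1) (by omega)
    positivity
  · have h1 : Tendsto (fun k : ℕ => ρ ^ (L ^ (k + 1)) * θ⁻¹) atTop (𝓝 (0 * θ⁻¹)) := by
      refine Tendsto.mul_const _ ?_
      refine (tendsto_pow_atTop_nhds_zero_of_lt_one hρ0.le hρ1).comp ?_
      exact (tendsto_pow_atTop_atTop_of_one_lt (by omega)).comp (tendsto_add_atTop_nat 1)
    rw [zero_mul] at h1
    refine h1.congr (fun k => ?_)
    change _ = ‖|stablePoint L ρ (k + 1 + 1)| / θ ^ (k + 1 + 1)‖ /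
      ‖|stablePoint L ρ (k + 1)| / θ ^ (k + 1)‖
    have h2 := stablePoint_pos L hρ0 (k + 1)
    have h3 := stablePoint_pos L hρ0 (k + 1 + 1)
    have h4 : stablePoint L ρ (k + 1 + 1) = stablePoint L ρ (k + 1) * ρ ^ (L ^ (k + 1)) := by
      rw [stablePoint, stablePoint, Finset.sum_range_succ _ (k + 1), pow_add]
    rw [abs_of_pos h2, abs_of_pos h3, Real.norm_of_nonneg (by positivity),
      Real.norm_of_nonneg (by positivity), h4]
    field_simp
    ring

theorem stablePointSummable_geometric_one {ρ θ : ℝ} (hρ0 : 0 < ρ) (hθ : 0 < θ) (h : ρ < θ) :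
    StablePointSummable 1 ρ (geometricWeight θ hθ) := by
  have h1 : Summable fun k : ℕ => (ρ / θ) ^ k :=
    summable_geometric_of_lt_one (by positivity) ((div_lt_one hθ).2 h)
  refine ((summable_nat_add_iff 1).2 h1).congr (fun k => ?_)
  change _ = |stablePoint 1 ρ (k + 1)| / θ ^ (k + 1)
  rw [abs_of_pos (stablePoint_pos 1 hρ0 _), stablePoint, div_pow]
  simp

/-! ### One-parameter groups of bounded operators -/

section Exponential

variable {E : Type*} [NormedAddCommGroup E] [NormedSpace ℝ E] [CompleteSpace E]

theorem exp_smul_add (K : E →L[ℝ] E) (s t : ℝ) :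
    NormedSpace.exp ((s + t) • K) = NormedSpace.exp (s • K) * NormedSpace.exp (t • K) := by
  let _ := NormedAlgebra.restrictScalars ℚ ℝ (E →L[ℝ] E)
  rw [add_smul]
  exact NormedSpace.exp_add_of_commute (((Commute.refl K).smul_left s).smul_right t)

theorem exp_smul_mul_neg (K : E →L[ℝ] E) (t : ℝ) :
    NormedSpace.exp (t • K) * NormedSpace.exp (-t • K) = 1 := by
  rw [← exp_smul_add, add_neg_cancel, zero_smul, NormedSpace.exp_zero]

theorem hasDerivAt_exp_smul_apply (K : E →L[ℝ] E) (x : E) (t : ℝ) :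
    HasDerivAt (fun s : ℝ => NormedSpace.exp (s • K) x) (K (NormedSpace.exp (t • K) x)) t :=
  (hasDerivAt_exp_smul_const' K t).clm_apply (hasDerivAt_const t x) |>.congr_deriv (by simp)

theorem hasDerivAt_exp_neg_smul (K : E →L[ℝ] E) (t : ℝ) :
    HasDerivAt (fun s : ℝ => NormedSpace.exp (-s • K)) (-(NormedSpace.exp (-t • K) * K)) t := by
  have h := (hasDerivAt_exp_smul_const K (-t)).scomp t (hasDerivAt_neg t)
  exact h.congr_deriv (by simp)

/-- The function `e^{-tK} z(t)` has vanishing right derivative, hence is constant. -/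
theorem eq_exp_smul_apply_of_hasDerivWithinAt (K : E →L[ℝ] E) {z : ℝ → E}
    (hz : ∀ t : ℝ, 0 ≤ t → HasDerivWithinAt z (K (z t)) (Set.Ici 0) t) {t : ℝ} (ht : 0 ≤ t) :
    z t = NormedSpace.exp (t • K) (z 0) := by
  have hd (s : ℝ) (hs : 0 ≤ s) :
      HasDerivWithinAt (fun s => NormedSpace.exp (-s • K) (z s)) 0 (Set.Ici 0) s :=
    ((hasDerivAt_exp_neg_smul K s).hasDerivWithinAt.clm_apply (hz s hs)).congr_deriv (by simp)
  have hc := constant_of_has_deriv_right_zero (a := 0) (b := t)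
    (fun s hs => ((hd s hs.1).mono Set.Icc_subset_Ici_self).continuousWithinAt)
    (fun s hs => (hd s hs.1).mono (Set.Ici_subset_Ici.2 hs.1)) t ⟨ht, le_rfl⟩
  have h := congrArg (fun y => (NormedSpace.exp (t • K) : E →L[ℝ] E) y) hc
  beta_reduce at h
  have h' (x : E) : NormedSpace.exp (t • K) (NormedSpace.exp (-t • K) x) = x :=
    DFunLike.congr_fun (exp_smul_mul_neg K t) x
  rw [h', neg_zero, zero_smul, NormedSpace.exp_zero] at h
  exact h

theorem hasSum_exp_smul_apply (K : E →L[ℝ] E) (t : ℝ) (ℓ : E →L[ℝ] ℝ) (x : E) :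
    HasSum (fun n : ℕ => t ^ n / n.factorial * ℓ ((K ^ n) x)) (ℓ (NormedSpace.exp (t • K) x)) := by
  have h := NormedSpace.exp_series_hasSum_exp' (𝕂 := ℝ) (t • K)
  have h' := (ℓ ∘L ContinuousLinearMap.apply ℝ E x).hasSum h
  refine h'.congr_fun (fun n => ?_)
  rw [_root_.smul_pow, smul_smul, map_smul, smul_eq_mul, div_eq_inv_mul]
  rfl

/-- The basis of uniformization: positivity of `e^{tK}` can be read off from any shift of `K` by a
multiple of the identity. -/
theorem exp_smul_eq_exp_shift (K : E →L[ℝ] E) (c t : ℝ) :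
    NormedSpace.exp (t • K) =
      Real.exp (-(c * t)) • NormedSpace.exp (t • (K + c • (1 : E →L[ℝ] E))) := by
  have h : t • K = t • (K + c • (1 : E →L[ℝ] E)) + (-(c * t)) • (1 : E →L[ℝ] E) := by
    rw [smul_add, smul_smul, neg_smul, mul_comm t c]
    abel
  have h1 : NormedSpace.exp ((-(c * t)) • (1 : E →L[ℝ] E)) =
      Real.exp (-(c * t)) • (1 : E →L[ℝ] E) := by
    have := NormedSpace.algebraMap_exp_comm (𝔸 := E →L[ℝ] E) (-(c * t))
    rw [Algebra.algebraMap_eq_smul_one, Algebra.algebraMap_eq_smul_one] at this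
    rw [← this, Real.exp_eq_exp_ℝ]
  let _ := NormedAlgebra.restrictScalars ℚ ℝ (E →L[ℝ] E)
  rw [h, NormedSpace.exp_add_of_commute ((Commute.one_right _).smul_right _), h1]
  simp

end Exponential

/-! ### The transition function -/

/-- The matrix entries `(𝒦ⁿ)(k, j)` of the powers of the drift. -/
def driftPow (L : ℕ) (β ρ : ℝ) (n : ℕ) (j : ℕ+) : ℕ → ℝ :=
  (drift L β ρ)^[n] (Pi.single (j : ℕ) 1)

theorem driftPow_succ (L : ℕ) (β ρ : ℝ) (n : ℕ) (j : ℕ+) :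
    driftPow L β ρ (n + 1) j = drift L β ρ (driftPow L β ρ n j) :=
  Function.iterate_succ_apply' _ _ _

/-- The transition probabilities `p_t(j, i)`, as entries of the exponential of the transposed
drift. -/
def transition (L : ℕ) (β ρ t : ℝ) (j i : ℕ+) : ℝ :=
  ∑' n : ℕ, t ^ n / n.factorial * driftPow L β ρ n j i

section Transition

variable {L : ℕ} {β ρ : ℝ} {w : Weight} {𝒦 : L2 w →L[ℝ] L2 w}

theorem pow_single_apply (h𝒦 : ∀ (x : L2 w) (k : ℕ), 𝒦 x k = drift L β ρ x k) (n : ℕ) (j : ℕ+) :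
    (((𝒦 ^ n) (L2.single w j)).1 : ℕ → ℝ) = driftPow L β ρ n j := by
  induction n with
  | zero => rfl
  | succ n ih =>
    rw [pow_succ', driftPow_succ, ← ih]
    exact funext (h𝒦 _)

/-- The right side does not depend on `w`, so properties of the matrix proved with one admissible
weight hold for all. -/
theorem exp_single_apply (h𝒦 : ∀ (x : L2 w) (k : ℕ), 𝒦 x k = drift L β ρ x k) (t : ℝ)
    (j i : ℕ+) : NormedSpace.exp (t • 𝒦) (L2.single w j) i = transition L β ρ t j i := by
  have h := hasSum_exp_smul_apply 𝒦 t (L2.coord w i) (L2.single w j)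
  simp only [L2.coord_apply] at h
  rw [← h.tsum_eq]
  simp only [pow_single_apply h𝒦]
  rfl

theorem hasSum_transition (h𝒦 : ∀ (x : L2 w) (k : ℕ), 𝒦 x k = drift L β ρ x k) (t : ℝ)
    (x : L2 w) (i : ℕ+) :
    HasSum (fun j : ℕ+ => transition L β ρ t j i * x j) (NormedSpace.exp (t • 𝒦) x i) := by
  simpa only [exp_single_apply h𝒦] using L2.hasSum_apply x (NormedSpace.exp (t • 𝒦)) i

/-- The drift is mass-decreasing on nonnegative summable sequences, once it is shifted by a
constant that makes it positivity preserving. -/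
theorem shifted_drift_nonneg_and_mass_le (hρ0 : 0 < ρ) (hρ1 : ρ < 1) (hβ : 0 < β)
    {x : ℕ → ℝ} (h0 : x 0 = 0) (hx : ∀ k, 0 ≤ x k) {S : ℝ} (hS : HasSum (fun k => x (k + 1)) S) :
    (∀ k, 0 ≤ drift L β ρ x k + (β * L + β) * x k) ∧
    ∃ S' ≤ (β * L + β) * S,
      HasSum (fun k => drift L β ρ x (k + 1) + (β * L + β) * x (k + 1)) S' := by
  have hp (k : ℕ) : 0 < ρ ^ (L ^ k) := pow_pos hρ0 _
  have hp1 (k : ℕ) : ρ ^ (L ^ k) ≤ 1 := pow_le_one₀ hρ0.le hρ1.le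
  have hβL : 0 ≤ β * L := by positivity
  constructor
  · rintro (_ | k)
    · simp [drift, h0]
    · have h1 : β * L * ρ ^ (L ^ (k + 1)) * x (k + 1) ≤ β * L * x (k + 1) :=
        mul_le_mul_of_nonneg_right (mul_le_of_le_one_right hβL (hp1 _)) (hx _)
      have h2 : 0 ≤ β * L * ρ ^ (L ^ k) * x k :=
        mul_nonneg (mul_nonneg hβL (hp k).le) (hx k)
      have h3 : 0 ≤ β * x (k + 2) := mul_nonneg hβ.le (hx _)
      rw [drift]
      linarith
  · have hf1 : Summable fun k => β * L * ρ ^ (L ^ (k + 1)) * x (k + 1) := by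
      refine Summable.of_nonneg_of_le (fun k => ?_) (fun k => ?_) (hS.summable.mul_left (β * L))
      · exact mul_nonneg (mul_nonneg hβL (hp _).le) (hx _)
      · exact mul_le_mul_of_nonneg_right (mul_le_of_le_one_right hβL (hp1 _)) (hx _)
    -- `F` is the total upward flow. It enters the mass balance with both signs and cancels; the
    -- downward flow loses only `β x(1)`, the killing at state `1`.
    obtain ⟨F, hF⟩ := hf1
    have hF0 : HasSum (fun k => β * L * ρ ^ (L ^ k) * x k) F := by
      rw [← hasSum_nat_add_iff' 1]
      simpa [h0] using hF
    have hS2 : HasSum (fun k => x (k + 2)) (S - x 1) := by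
      simpa using (hasSum_nat_add_iff' 1).2 hS
    have hsum := ((hF0.sub (hF.add (hS.mul_left β))).add (hS2.mul_left β)).add
      (hS.mul_left (β * L + β))
    refine ⟨_, ?_, hsum.congr_fun (fun k => ?_)⟩
    · have := mul_nonneg hβ.le (hx 1)
      linarith
    · rw [drift]
      ring

theorem shifted_pow_single (hρ0 : 0 < ρ) (hρ1 : ρ < 1) (hβ : 0 < β)
    (h𝒦 : ∀ (x : L2 w) (k : ℕ), 𝒦 x k = drift L β ρ x k) (j : ℕ+) (n : ℕ) :
    (∀ k, 0 ≤ (((𝒦 + (β * L + β) • (1 : L2 w →L[ℝ] L2 w)) ^ n) (L2.single w j)) k) ∧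
    ∃ S ≤ (β * L + β) ^ n,
      HasSum (fun k => (((𝒦 + (β * L + β) • (1 : L2 w →L[ℝ] L2 w)) ^ n) (L2.single w j)) (k + 1))
        S := by
  induction n with
  | zero =>
    refine ⟨fun k => ?_, 1, by simp, ?_⟩
    · simp only [pow_zero, one_apply_eq_self, L2.single_coe, Pi.single_apply]
      split_ifs <;> norm_num
    · simp only [pow_zero, one_apply_eq_self, L2.single_coe]
      have h := hasSum_ite_eq (PNat.natPred j) (1 : ℝ)
      refine h.congr_fun (fun k => ?_)
      have : k + 1 = (j : ℕ) ↔ k = PNat.natPred j := by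
        have := PNat.natPred_add_one j
        omega
      simp [Pi.single_apply, this]
  | succ n ih =>
    obtain ⟨h0, S, hS, hsum⟩ := ih
    set x := ((𝒦 + (β * L + β) • (1 : L2 w →L[ℝ] L2 w)) ^ n) (L2.single w j) with hx
    have key := shifted_drift_nonneg_and_mass_le (L := L) hρ0 hρ1 hβ x.2.1 h0 hsum
    have hstep (k : ℕ) :
        (((𝒦 + (β * L + β) • (1 : L2 w →L[ℝ] L2 w)) ^ (n + 1)) (L2.single w j)) k =
          drift L β ρ x k + (β * L + β) * x k := by
      rw [← h𝒦, pow_succ']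
      rfl
    simp only [hstep]
    obtain ⟨h1, S', hS', hsum'⟩ := key
    refine ⟨h1, S', hS'.trans ?_, hsum'⟩
    rw [pow_succ']
    gcongr

/-- With `c = βL + β`, the `n`-th power of the shifted drift sends a unit vector to a nonnegative
sequence of mass at most `c^n`. The mass of `e^{t𝒦} e_j` is then at most the total Poisson mass `∑
e^{-ct} (ct)^n / n! = 1`. -/
theorem transition_nonneg_and_sum_le (hρ0 : 0 < ρ) (hρ1 : ρ < 1) (hβ : 0 < β)
    (h𝒦 : ∀ (x : L2 w) (k : ℕ), 𝒦 x k = drift L β ρ x k) {t : ℝ} (ht : 0 ≤ t) (j : ℕ+) :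
    (∀ i, 0 ≤ transition L β ρ t j i) ∧
    ∀ s : Finset ℕ+, ∑ i ∈ s, transition L β ρ t j i ≤ 1 := by
  set c := β * L + β with hc
  have hc0 : 0 ≤ c := by positivity
  set y : ℕ → L2 w := fun n => ((𝒦 + c • (1 : L2 w →L[ℝ] L2 w)) ^ n) (L2.single w j) with hy
  have key := shifted_pow_single (L := L) hρ0 hρ1 hβ h𝒦 j
  have hexp (i : ℕ+) : HasSum (fun n : ℕ => Real.exp (-(c * t)) * (t ^ n / n.factorial * y n i))
      (transition L β ρ t j i) := by
    have h := (hasSum_exp_smul_apply (𝒦 + c • (1 : L2 w →L[ℝ] L2 w)) t (L2.coord w i)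
      (L2.single w j)).mul_left (Real.exp (-(c * t)))
    rw [← exp_single_apply h𝒦, exp_smul_eq_exp_shift 𝒦 c t]
    simp only [L2.coord_apply] at h
    exact h
  refine ⟨fun i => (hexp i).nonneg fun n => ?_, fun s => ?_⟩
  · have := (key n).1 i
    positivity
  · have h1 := hasSum_sum (s := s) (fun i _ => hexp i)
    have h2 : HasSum (fun n : ℕ => Real.exp (-(c * t)) * ((c * t) ^ n / n.factorial)) 1 := by
      have h := (NormedSpace.expSeries_div_hasSum_exp (c * t)).mul_left (Real.exp (-(c * t)))
      rwa [← Real.exp_eq_exp_ℝ, ← Real.exp_add, neg_add_cancel, Real.exp_zero] at h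
    refine hasSum_le (fun n => ?_) h1 h2
    rw [← Finset.mul_sum, ← Finset.mul_sum]
    obtain ⟨h0, S, hS, hsum⟩ := key n
    have h3 : ∑ i ∈ s, y n i ≤ c ^ n := by
      have h4 : HasSum (fun i : ℕ+ => y n i) S := by
        rw [← Equiv.pnatEquivNat.symm.hasSum_iff]
        exact hsum
      exact (sum_le_hasSum s (fun i _ => h0 i) h4).trans hS
    calc Real.exp (-(c * t)) * (t ^ n / n.factorial * ∑ i ∈ s, y n i)
        ≤ Real.exp (-(c * t)) * (t ^ n / n.factorial * c ^ n) := by gcongr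
      _ = _ := by rw [mul_pow]; ring

theorem drift_single (j i : ℕ+) :
    drift L β ρ (Pi.single (j : ℕ) 1) i = generator L β ρ j i := by
  obtain ⟨k, hk⟩ : ∃ k : ℕ, (i : ℕ) = k + 1 := Nat.exists_eq_add_of_le' i.pos
  have hij : j = i ↔ (j : ℕ) = k + 1 := by rw [← PNat.coe_inj, hk]
  simp only [generator, hk, drift, Pi.single_apply, hij]
  have hj := j.pos
  rcases lt_trichotomy (k + 1) (j : ℕ) with h | h | h
  · rcases eq_or_ne (k + 2) (j : ℕ) with h' | h'
    · rw [if_neg (by omega), if_neg (by omega), if_pos h', if_neg (by omega), if_pos (by omega)]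
      ring
    · rw [if_neg (by omega), if_neg (by omega), if_neg h', if_neg (by omega), if_neg (by omega),
        if_neg (by omega)]
      ring
  · rw [if_neg (by omega), if_pos (by omega), if_neg (by omega), if_neg (by omega),
      if_neg (by omega), if_pos (by omega), h]
    ring
  · rcases eq_or_ne k (j : ℕ) with h' | h'
    · rw [if_pos (by omega), if_neg (by omega), if_neg (by omega), if_pos (by omega), h']
      ring
    · rw [if_neg (by omega), if_neg (by omega), if_neg (by omega), if_neg (by omega),
        if_neg (by omega), if_neg (by omega)]
      ring

/-- The vector `e^{t𝒦} e_j` lists the row `p_t(j, ·)`. Chapman–Kolmogorov is therefore the group law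
applied to a unit vector, and the generator is the transposed matrix of `𝒦`. -/
theorem isTransitionFunction_transition (hρ0 : 0 < ρ) (hρ1 : ρ < 1) (hβ : 0 < β)
    (h𝒦 : ∀ (x : L2 w) (k : ℕ), 𝒦 x k = drift L β ρ x k) :
    IsTransitionFunction (generator L β ρ) (transition L β ρ) where
  nonneg t ht i := (transition_nonneg_and_sum_le hρ0 hρ1 hβ h𝒦 ht i).1
  summable t ht i := summable_of_sum_le (transition_nonneg_and_sum_le hρ0 hρ1 hβ h𝒦 ht i).1
    (transition_nonneg_and_sum_le hρ0 hρ1 hβ h𝒦 ht i).2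
  sum_le_one t ht i := Real.tsum_le_of_sum_le (transition_nonneg_and_sum_le hρ0 hρ1 hβ h𝒦 ht i).1
    (transition_nonneg_and_sum_le hρ0 hρ1 hβ h𝒦 ht i).2
  zero i j := by
    rw [← exp_single_apply h𝒦, zero_smul, NormedSpace.exp_zero, one_apply_eq_self,
      L2.single_coe, Pi.single_apply]
    simp only [PNat.coe_inj, eq_comm]
  chapman_kolmogorov s t _ _ i j := by
    have h := hasSum_transition h𝒦 t (NormedSpace.exp (s • 𝒦) (L2.single w i)) j
    rw [← mul_apply_eq_comp, ← exp_smul_add, add_comm t s, exp_single_apply h𝒦] at h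
    simpa only [exp_single_apply h𝒦, mul_comm] using h
  deriv_zero i j := by
    have h := (L2.coord w j).hasFDerivAt.comp_hasDerivAt (0 : ℝ)
      (hasDerivAt_exp_smul_apply 𝒦 (L2.single w i) 0)
    rw [zero_smul, NormedSpace.exp_zero, one_apply_eq_self, L2.coord_apply, h𝒦,
      L2.single_coe, drift_single] at h
    refine (h.congr_of_eventuallyEq (Eventually.of_forall fun t => ?_)).hasDerivWithinAt
    simp only [Function.comp_apply, L2.coord_apply, exp_single_apply h𝒦]

end Transition

/-! ### The spectral measure -/

section State

variable {A : Type*} [CStarAlgebra A]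

/-- The distribution of a positive element `b* b` in a state of a `C*`-algebra. -/
theorem exists_measure_of_state (b : A) (Λ : A →ₗ[ℂ] ℂ) (hΛ : ∀ x, 0 ≤ (Λ (star x * x)).re)
    (h1 : Λ 1 = 1) :
    ∃ ν : Measure ℝ, IsProbabilityMeasure ν ∧ (∃ M, ∀ᵐ x ∂ν, x ∈ Set.Icc 0 M) ∧
      ∀ p : ℝ[X], ∫ x, p.eval x ∂ν =
        (Λ (aeval (star b * b) (p.map (algebraMap ℝ ℂ)))).re := by
  set a := star b * b with ha
  have hsa : IsSelfAdjoint a := IsSelfAdjoint.star_mul_self b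
  set φ := cfcHom (R := ℝ) hsa with hφ
  have : CompactSpace (spectrum ℝ a) := isCompact_iff_compactSpace.1 (spectrum.isCompact a)
  -- A nonnegative function on the spectrum is the square of its root, so the functional calculus
  -- turns it into an element `x* x`, on which the state is nonnegative.
  have hΛ' (f : C(spectrum ℝ a, ℝ)) (hf : ∀ x, 0 ≤ f x) : 0 ≤ (Λ (φ f)).re := by
    let g : C(spectrum ℝ a, ℝ) := ⟨fun x => √(f x), by fun_prop⟩
    have hg : f = star g * g := by
      ext x
      exact (Real.mul_self_sqrt (hf x)).symm
    rw [hg, map_mul, map_star]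
    exact hΛ _
  let Ψ : CompactlySupportedContinuousMap (spectrum ℝ a) ℝ →ₗ[ℝ] ℝ :=
    { toFun := fun f => (Λ (φ f.toContinuousMap)).re
      map_add' := fun f g => by
        rw [← Complex.add_re, ← map_add, ← map_add]
        rfl
      map_smul' := fun r f => by
        have : (r • f).toContinuousMap = r • f.toContinuousMap := rfl
        rw [this, map_smul]
        have h2 : r • φ f.toContinuousMap = (r : ℂ) • φ f.toContinuousMap := rfl
        rw [h2, map_smul]
        simp }
  let Ψ' : CompactlySupportedContinuousMap (spectrum ℝ a) ℝ →ₚ[ℝ] ℝ :=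
    PositiveLinearMap.mk₀ Ψ (fun f hf => hΛ' _ hf)
  -- Riesz–Markov on the compact spectrum. The measure wanted on `ℝ` is its image under inclusion.
  set ν := RealRMK.rieszMeasure Ψ' with hν
  have hint (f : C(spectrum ℝ a, ℝ)) : ∫ x, f x ∂ν = (Λ (φ f)).re :=
    RealRMK.integral_rieszMeasure Ψ' (CompactlySupportedContinuousMap.continuousMapEquiv f)
  have hprob : IsProbabilityMeasure ν := by
    have h := hint 1
    rw [map_one, h1] at h
    simp only [ContinuousMap.one_apply, integral_const, smul_eq_mul, mul_one, Complex.one_re,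
      measureReal_def] at h
    exact ⟨(ENNReal.toReal_eq_one_iff _).1 h⟩
  refine ⟨ν.map Subtype.val, Measure.isProbabilityMeasure_map (by fun_prop), ?_, fun p => ?_⟩
  · obtain ⟨M, hM⟩ := (spectrum.isCompact (𝕜 := ℝ) a).bddAbove
    refine ⟨M, ?_⟩
    refine (ae_map_iff (p := fun x => x ∈ Set.Icc 0 M)
      measurable_subtype_coe.aemeasurable measurableSet_Icc).2 ?_
    exact Eventually.of_forall fun x => ⟨spectrum_star_mul_self_nonneg x x.2, hM x.2⟩
  · rw [integral_map (by fun_prop) (by fun_prop)]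
    have h := hint (p.toContinuousMapOn (spectrum ℝ a))
    rw [show (∫ x, p.toContinuousMapOn (spectrum ℝ a) x ∂ν) = ∫ x : spectrum ℝ a, p.eval (x : ℝ) ∂ν
      from rfl] at h
    rw [h]
    have hp : φ (p.toContinuousMapOn (spectrum ℝ a)) = aeval a p := by
      have h3 : (φ : C(spectrum ℝ a, ℝ) →ₐ[ℝ] A).comp
          (toContinuousMapOnAlgHom (spectrum ℝ a)) = aeval a := by
        refine Polynomial.algHom_ext ?_
        rw [aeval_X]
        have h4 : toContinuousMapOnAlgHom (spectrum ℝ a) X =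
            (ContinuousMap.id ℝ).restrict (spectrum ℝ a) := by
          ext x
          simp
        change φ (toContinuousMapOnAlgHom (spectrum ℝ a) X) = a
        rw [h4]
        exact cfcHom_id hsa
      exact DFunLike.congr_fun h3 p
    rw [hp, aeval_map_algebraMap]

end State

/-! ### The Jacobi operator -/

/-- The complex sequence space `ℓ²`, on which the symmetrized generator acts. -/
abbrev SeqSpace : Type := lp (fun _ : ℕ => ℂ) 2

/-- The unit vectors of `ℓ²`. -/
def unitVec (k : ℕ) : SeqSpace := lp.single 2 k 1

theorem inner_unitVec_left (k : ℕ) (f : SeqSpace) : inner ℂ (unitVec k) f = f k := by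
  rw [unitVec, lp.inner_single_left]
  simp

theorem unitVec_apply (k n : ℕ) : unitVec k n = if n = k then 1 else 0 := by
  rw [unitVec, lp.single_apply, Pi.single_apply]

theorem seqSpace_norm_sq (f : SeqSpace) : HasSum (fun n => ‖f n‖ ^ 2) (‖f‖ ^ 2) := by
  have h := lp.hasSum_norm (p := 2) (by norm_num) f
  simpa using h

theorem exists_weightedShift {ℓ : ℕ → ℝ} {D : ℝ} (hℓ : ∀ n, |ℓ n| ≤ D) :
    ∃ R : SeqSpace →L[ℂ] SeqSpace, (∀ f, R f 0 = 0) ∧ ∀ f n, R f (n + 1) = ℓ n * f n := by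
  have hD : 0 ≤ D := (abs_nonneg _).trans (hℓ 0)
  let g (f : ℕ → ℂ) (n : ℕ) : ℂ := n.rec 0 fun m _ => ℓ m * f m
  have hg (f : SeqSpace) : Summable (fun n => ‖g f n‖ ^ 2) ∧
      ∑' n, ‖g f n‖ ^ 2 ≤ D ^ 2 * ‖f‖ ^ 2 := by
    have hs := (seqSpace_norm_sq f).mul_left (D ^ 2)
    have hle (n : ℕ) : ‖g f (n + 1)‖ ^ 2 ≤ D ^ 2 * ‖f n‖ ^ 2 := by
      change ‖(ℓ n : ℂ) * f n‖ ^ 2 ≤ _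
      rw [norm_mul, mul_pow, Complex.norm_real, Real.norm_eq_abs]
      have := hℓ n
      gcongr
    have h1 : Summable fun n => ‖g f (n + 1)‖ ^ 2 :=
      Summable.of_nonneg_of_le (fun n => sq_nonneg _) hle hs.summable
    have h2 : Summable fun n => ‖g f n‖ ^ 2 := (summable_nat_add_iff 1).1 h1
    refine ⟨h2, ?_⟩
    rw [h2.tsum_eq_zero_add, ← hs.tsum_eq]
    have : ‖g f 0‖ ^ 2 = 0 := by simp [g]
    rw [this, zero_add]
    exact h1.tsum_le_tsum hle hs.summable
  have hmem (f : SeqSpace) : Memℓp (g f) 2 := memℓp_gen (by simpa using (hg f).1)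
  let T : SeqSpace →ₗ[ℂ] SeqSpace :=
    { toFun := fun f => ⟨g f, hmem f⟩
      map_add' := fun f f' => by
        ext n
        cases n with
        | zero => exact (add_zero (0 : ℂ)).symm
        | succ n => exact mul_add _ _ _
      map_smul' := fun c f => by
        ext n
        cases n with
        | zero => exact (mul_zero c).symm
        | succ n => exact mul_left_comm _ _ _ }
  refine ⟨T.mkContinuous D (fun f => ?_), fun f => rfl, fun f n => rfl⟩
  refine le_of_sq_le_sq ?_ (by positivity)
  rw [mul_pow, ← (seqSpace_norm_sq (T f)).tsum_eq]
  exact (hg f).2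

/-- A Jacobi operator in factorized form. -/
theorem exists_jacobi {s : ℝ} {ℓ : ℕ → ℝ} {D : ℝ} (hℓ : ∀ n, |ℓ n| ≤ D) :
    ∃ S : SeqSpace →L[ℂ] SeqSpace,
      (star S * S) (unitVec 0) =
        ((s ^ 2 + ℓ 0 ^ 2 : ℝ) : ℂ) • unitVec 0 - ((s * ℓ 0 : ℝ) : ℂ) • unitVec 1 ∧
      ∀ n, (star S * S) (unitVec (n + 1)) =
        ((s ^ 2 + ℓ (n + 1) ^ 2 : ℝ) : ℂ) • unitVec (n + 1) - ((s * ℓ n : ℝ) : ℂ) • unitVec n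
          - ((s * ℓ (n + 1) : ℝ) : ℂ) • unitVec (n + 2) := by
  obtain ⟨R, hR0, hR⟩ := exists_weightedShift hℓ
  have hRe (k : ℕ) : R (unitVec k) = (ℓ k : ℂ) • unitVec (k + 1) := by
    ext n
    rw [lp.coeFn_smul, Pi.smul_apply, smul_eq_mul, unitVec_apply]
    cases n with
    | zero => simp [hR0]
    | succ n =>
      by_cases h : n = k
      · subst h
        simp [hR, unitVec_apply]
      · simp [hR, unitVec_apply, h]
  have hadj0 : star R (unitVec 0) = 0 := by
    refine ext_inner_right ℂ (fun f => ?_)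
    rw [ContinuousLinearMap.star_eq_adjoint, ContinuousLinearMap.adjoint_inner_left,
      inner_unitVec_left, hR0, inner_zero_left]
  have hadj (k : ℕ) : star R (unitVec (k + 1)) = (ℓ k : ℂ) • unitVec k := by
    refine ext_inner_right ℂ (fun f => ?_)
    rw [ContinuousLinearMap.star_eq_adjoint, ContinuousLinearMap.adjoint_inner_left,
      inner_unitVec_left, hR, inner_smul_left, inner_unitVec_left, Complex.conj_ofReal]
  -- Take `S = s - R` with `R` the weighted shift. The identity and `R* R` give the diagonal `s² +
  -- ℓ_n²`, the cross terms give `-s ℓ_n`, and `R* e_0 = 0` accounts for the first row.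
  -- Factorization places the spectrum in `[0, ∞)`.
  refine ⟨(s : ℂ) • (1 : SeqSpace →L[ℂ] SeqSpace) - R, ?_, fun n => ?_⟩
  · rw [mul_apply_eq_comp]
    simp only [star_sub, star_smul, star_one, sub_apply, smul_apply,
      one_apply_eq_self, hRe, map_sub, map_smul, hadj0, hadj]
    simp
    module
  · rw [mul_apply_eq_comp]
    simp only [star_sub, star_smul, star_one, sub_apply, smul_apply,
      one_apply_eq_self, hRe, map_sub, map_smul, hadj]
    simp
    module

/-! ### The spectral measure of the birth and death process -/

section Spectral

variable {L : ℕ} {β ρ : ℝ}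

theorem integrable_of_ae_mem_Icc {ψ : Measure ℝ} [IsFiniteMeasure ψ] {M : ℝ}
    (hM : ∀ᵐ x ∂ψ, x ∈ Set.Icc 0 M) {f : ℝ → ℝ} (hf : Continuous f) : Integrable f ψ := by
  obtain ⟨C, hC⟩ := (isCompact_Icc (a := (0 : ℝ)) (b := M)).exists_bound_of_continuousOn
    hf.continuousOn
  exact Integrable.of_bound hf.aestronglyMeasurable C (hM.mono fun x hx => hC x hx)

theorem potential_pos (hL : 1 ≤ L) (hρ0 : 0 < ρ) (k : ℕ) : 0 < potential L ρ k := by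
  have : (0 : ℝ) < L := by exact_mod_cast hL
  unfold potential
  positivity

theorem potential_add_two (n : ℕ) :
    potential L ρ (n + 2) = L * ρ ^ (L ^ (n + 1)) * potential L ρ (n + 1) := by
  rw [potential, potential, Finset.sum_Ico_succ_top (by omega), pow_add]
  simp only [Nat.add_sub_cancel, pow_succ, Nat.reduceSubDiff]
  ring

theorem birthRate_pos (hL : 1 ≤ L) (hρ0 : 0 < ρ) (hβ : 0 < β) (n : ℕ) :
    0 < β * L * ρ ^ (L ^ n) := by
  have : (0 : ℝ) < L := by exact_mod_cast hL
  positivity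

theorem aeval_map_isSelfAdjoint {J : SeqSpace →L[ℂ] SeqSpace} (hJ : IsSelfAdjoint J) (p : ℝ[X]) :
    IsSelfAdjoint (aeval J (p.map (algebraMap ℝ ℂ))) := by
  rw [aeval_eq_sum_range]
  refine isSelfAdjoint_sum _ (fun i _ => IsSelfAdjoint.smul ?_ (hJ.pow i))
  rw [coeff_map]
  exact Complex.conj_ofReal _

theorem orthoPoly_add_two (n : ℕ) : orthoPoly L β ρ (n + 2) =
    C (β * L * ρ ^ (L ^ (n + 1)))⁻¹ *
      ((C (β * L * ρ ^ (L ^ (n + 1)) + β) - X) * orthoPoly L β ρ (n + 1)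
        - C β * orthoPoly L β ρ n) := by
  rw [orthoPoly]

/-- For `s = √β` and `ℓ_n = √λ_{n+1}` the operator `S* S` is the negative generator conjugated by
`√π`, with `e_n` standing for state `n + 1`. The three-term recurrence gives `Q_{n+1}(J) e_0 = c_n
e_n`. As `Q_{i+1}(J)` is self-adjoint, the integral of `Q_{i+1} Q_{j+1}` is the inner product of
`c_i e_i` and `c_j e_j`. The bound on the support makes every later integral of a continuous
function finite. -/
theorem exists_spectralMeasure (hL : 1 ≤ L) (hρ0 : 0 < ρ) (hρ1 : ρ < 1) (hβ : 0 < β) :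
    ∃ ψ : Measure ℝ, IsSpectralMeasure L β ρ ψ ∧ ∃ M, ∀ᵐ x ∂ψ, x ∈ Set.Icc 0 M := by
  have hL0 : (0 : ℝ) < L := by exact_mod_cast hL
  have hb := birthRate_pos (L := L) hL hρ0 hβ
  set s : ℝ := √β with hs
  set ℓ : ℕ → ℝ := fun n => √(β * L * ρ ^ (L ^ (n + 1))) with hℓ
  have hs0 : 0 < s := Real.sqrt_pos.2 hβ
  have hℓ0 (n : ℕ) : 0 < ℓ n := Real.sqrt_pos.2 (hb _)
  have hs2 : s ^ 2 = β := Real.sq_sqrt hβ.le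
  have hℓ2 (n : ℕ) : ℓ n ^ 2 = β * L * ρ ^ (L ^ (n + 1)) := Real.sq_sqrt (hb _).le
  have hℓD (n : ℕ) : |ℓ n| ≤ √(β * L) := by
    rw [abs_of_pos (hℓ0 n)]
    exact Real.sqrt_le_sqrt (mul_le_of_le_one_right (by positivity)
      (pow_le_one₀ hρ0.le hρ1.le))
  obtain ⟨S, hJ0, hJ⟩ := exists_jacobi (s := s) hℓD
  set J := star S * S with hJdef
  have hsa : IsSelfAdjoint J := IsSelfAdjoint.star_mul_self S
  set c : ℕ → ℝ := fun n => ∏ m ∈ Finset.range n, s / ℓ m with hc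
  have hc1 (n : ℕ) : c (n + 1) = c n * (s / ℓ n) := Finset.prod_range_succ _ _
  have hcπ (n : ℕ) : c n ^ 2 = (potential L ρ (n + 1))⁻¹ := by
    induction n with
    | zero => simp [hc, potential]
    | succ n ih =>
      rw [hc1, mul_pow, ih, div_pow, hs2, hℓ2, potential_add_two]
      have := potential_pos (L := L) hL hρ0 (n + 1)
      field_simp
  set q : ℕ → SeqSpace →L[ℂ] SeqSpace :=
    fun n => aeval J ((orthoPoly L β ρ n).map (algebraMap ℝ ℂ)) with hq
  have hq2 (n : ℕ) : q (n + 2) = ((ℓ n ^ 2 : ℝ) : ℂ)⁻¹ • (((s ^ 2 + ℓ n ^ 2 : ℝ) : ℂ) • q (n + 1)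
      - J * q (n + 1) - ((s ^ 2 : ℝ) : ℂ) • q n) := by
    have ha (r : ℝ) : aeval J (C (algebraMap ℝ ℂ r)) =
        (r : ℂ) • (1 : SeqSpace →L[ℂ] SeqSpace) := by
      rw [aeval_C, Algebra.algebraMap_eq_smul_one]
      rfl
    simp only [hq]
    rw [orthoPoly_add_two, ← hℓ2, hs2, add_comm (ℓ n ^ 2)]
    simp only [Polynomial.map_mul, Polynomial.map_sub, Polynomial.map_C, Polynomial.map_X,
      map_mul (aeval (R := ℂ) J), map_sub (aeval (R := ℂ) J), ha, aeval_X, sub_mul, smul_mul_assoc, one_mul,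
      Complex.ofReal_inv]
  have hq0 : q 0 (unitVec 0) = 0 := by simp [hq, orthoPoly]
  have hqe (n : ℕ) : q (n + 1) (unitVec 0) = (c n : ℂ) • unitVec n := by
    induction n using Nat.twoStepInduction with
    | zero => simp [hq, orthoPoly, hc]
    | one =>
      have hℓn : (ℓ 0 : ℂ) ≠ 0 := by exact_mod_cast (hℓ0 0).ne'
      have h1 : q 1 (unitVec 0) = unitVec 0 := by simp [hq, orthoPoly]
      have hc1' : c 1 = s / ℓ 0 := by simp [hc]
      rw [hq2]
      simp only [smul_apply, sub_apply, mul_apply_eq_comp, h1, hq0, hJ0, hc1', zero_add]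
      push_cast
      match_scalars <;> field_simp <;> ring
    | more n ih1 ih2 =>
      have hℓn : (ℓ (n + 1) : ℂ) ≠ 0 := by exact_mod_cast (hℓ0 (n + 1)).ne'
      have hℓn' : (ℓ n : ℂ) ≠ 0 := by exact_mod_cast (hℓ0 n).ne'
      rw [hq2]
      simp only [smul_apply, sub_apply, mul_apply_eq_comp, ih1, ih2, map_smul, hJ, hc1]
      push_cast
      match_scalars <;> field_simp <;> ring
  let Λ : (SeqSpace →L[ℂ] SeqSpace) →ₗ[ℂ] ℂ :=
    { toFun := fun T => inner ℂ (unitVec 0) (T (unitVec 0))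
      map_add' := fun T T' => inner_add_right _ _ _
      map_smul' := fun a T => inner_smul_right _ _ _ }
  have hinner (k n : ℕ) : inner ℂ (unitVec k) (unitVec n) = if k = n then (1 : ℂ) else 0 := by
    rw [inner_unitVec_left, unitVec_apply]
  obtain ⟨ψ, hψ, ⟨M, hM⟩, hint⟩ := exists_measure_of_state S Λ
    (fun T => by
      change 0 ≤ (inner ℂ (unitVec 0) ((star T * T) (unitVec 0))).re
      rw [mul_apply_eq_comp, ContinuousLinearMap.star_eq_adjoint,
        ContinuousLinearMap.adjoint_inner_right]
      exact inner_self_nonneg (𝕜 := ℂ))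
    (by
      change inner ℂ (unitVec 0) (unitVec 0) = 1
      rw [hinner, if_pos rfl])
  refine ⟨ψ, ⟨hψ, ?_, fun i j _ _ => ?_, fun i j hi hj => ?_⟩, M, hM⟩
  · rw [← nonpos_iff_eq_zero]
    refine (measure_mono fun x hx => ?_).trans (ae_iff.1 hM).le
    simp only [Set.mem_Iio] at hx
    simp [hx]
  · exact integrable_of_ae_mem_Icc hM (by fun_prop)
  · obtain ⟨i, rfl⟩ := Nat.exists_eq_add_of_le' hi
    obtain ⟨j, rfl⟩ := Nat.exists_eq_add_of_le' hj
    have h := hint (orthoPoly L β ρ (i + 1) * orthoPoly L β ρ (j + 1))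
    simp only [eval_mul] at h
    rw [h, Polynomial.map_mul, map_mul]
    change (inner ℂ (unitVec 0) (q (i + 1) (q (j + 1) (unitVec 0)))).re = _
    have hadj : q (i + 1) = ContinuousLinearMap.adjoint (q (i + 1)) :=
      (aeval_map_isSelfAdjoint hsa (orthoPoly L β ρ (i + 1))).star_eq.symm
    rw [hadj, ContinuousLinearMap.adjoint_inner_right, hqe, hqe]
    simp only [inner_smul_left, inner_smul_right, hinner, Complex.conj_ofReal]
    by_cases hij : i = j
    · subst hij
      rw [if_pos rfl, if_pos rfl, mul_one, ← hcπ, ← Complex.ofReal_mul, Complex.ofReal_re, sq]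
    · rw [if_neg hij, if_neg (by omega)]
      simp

theorem mul_eval_orthoPoly (hL : 1 ≤ L) (hρ0 : 0 < ρ) (hβ : 0 < β) (n : ℕ) (x : ℝ) :
    -x * (orthoPoly L β ρ (n + 1)).eval x = β * (orthoPoly L β ρ n).eval x
      - (β * L * ρ ^ (L ^ (n + 1)) + β) * (orthoPoly L β ρ (n + 1)).eval x
      + β * L * ρ ^ (L ^ (n + 1)) * (orthoPoly L β ρ (n + 2)).eval x := by
  have h := (birthRate_pos (L := L) hL hρ0 hβ (n + 1)).ne'
  rw [orthoPoly_add_two]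
  simp only [eval_mul, eval_sub, eval_C, eval_X, mul_inv_cancel_left₀ h]
  ring

theorem driftPow_apply_zero (n : ℕ) (j : ℕ+) : driftPow L β ρ n j 0 = 0 := by
  cases n with
  | zero => simp [driftPow, j.ne_zero.symm]
  | succ n => rw [driftPow_succ, drift]

/-- Multiplication by `-x` acts on the `Q_i` through their recurrence. Detailed balance, `λ_i π(i) =
β π(i+1)`, turns this action into that of the drift. -/
theorem driftPow_eq_integral (hL : 1 ≤ L) (hρ0 : 0 < ρ) (hβ : 0 < β) {ψ : Measure ℝ}
    (hψ : IsSpectralMeasure L β ρ ψ) {M : ℝ} (hM : ∀ᵐ x ∂ψ, x ∈ Set.Icc 0 M) (n : ℕ) (j : ℕ+)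
    (i : ℕ) : driftPow L β ρ n j (i + 1) = potential L ρ (i + 1) *
      ∫ x, (-x) ^ n * ((orthoPoly L β ρ (i + 1)).eval x * (orthoPoly L β ρ j).eval x) ∂ψ := by
  have := hψ.isProbabilityMeasure
  induction n generalizing i with
  | zero =>
    simp only [pow_zero, one_mul]
    rw [hψ.orthogonal _ _ (by omega) j.pos]
    have := (potential_pos (L := L) hL hρ0 (i + 1)).ne'
    simp only [driftPow, Function.iterate_zero, id, Pi.single_apply]
    split_ifs <;> simp [this]
  | succ n ih =>
    set m : ℕ → ℝ := fun k =>
      ∫ x, (-x) ^ n * ((orthoPoly L β ρ k).eval x * (orthoPoly L β ρ j).eval x) ∂ψ with hm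
    have hI (k : ℕ) : Integrable
        (fun x => (-x) ^ n * ((orthoPoly L β ρ k).eval x * (orthoPoly L β ρ j).eval x)) ψ :=
      integrable_of_ae_mem_Icc hM (by fun_prop)
    have hrec : ∫ x, (-x) ^ (n + 1) * ((orthoPoly L β ρ (i + 1)).eval x *
        (orthoPoly L β ρ j).eval x) ∂ψ = β * m i - (β * L * ρ ^ (L ^ (i + 1)) + β) * m (i + 1)
          + β * L * ρ ^ (L ^ (i + 1)) * m (i + 2) := by
      have hI' : Integrable (fun x =>
          β * ((-x) ^ n * ((orthoPoly L β ρ i).eval x * (orthoPoly L β ρ j).eval x)) -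
          (β * L * ρ ^ (L ^ (i + 1)) + β) *
            ((-x) ^ n * ((orthoPoly L β ρ (i + 1)).eval x * (orthoPoly L β ρ j).eval x))) ψ :=
        integrable_of_ae_mem_Icc hM (by fun_prop)
      simp only [hm]
      rw [← integral_const_mul, ← integral_const_mul, ← integral_const_mul,
        ← integral_sub ((hI i).const_mul _) ((hI (i + 1)).const_mul _),
        ← integral_add hI' ((hI (i + 2)).const_mul _)]
      refine integral_congr_ae (Eventually.of_forall fun x => ?_)
      have h := mul_eval_orthoPoly (L := L) hL hρ0 hβ i x
      beta_reduce
      calc (-x) ^ (n + 1) * ((orthoPoly L β ρ (i + 1)).eval x * (orthoPoly L β ρ j).eval x)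
          = (-x) ^ n * (-x * (orthoPoly L β ρ (i + 1)).eval x) * (orthoPoly L β ρ j).eval x := by
            ring
        _ = _ := by rw [h]; ring
    rw [hrec, driftPow_succ, drift, ih i, ih (i + 1), potential_add_two]
    change _ * driftPow L β ρ n j i - _ * (_ * m (i + 1)) + _ * (_ * m (i + 2)) = _
    -- Detailed balance for `i ≥ 1`; for `i = 0` both sides vanish because the sequence is `0` at
    -- `0` and `Q_0 = 0`.
    have h0 : β * L * ρ ^ (L ^ i) * driftPow L β ρ n j i = potential L ρ (i + 1) * (β * m i) := by
      cases i with
      | zero => simp [driftPow_apply_zero, hm, orthoPoly]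
      | succ i =>
        rw [ih i, potential_add_two]
        ring
    rw [h0]
    ring

/-- The exponential series may be summed under the integral because `ψ` lives on `[0, M]`. The case
`m = 0` is the formula for the transition probabilities; `m = 1` is the kernel that appears after
partial integration in time. -/
theorem exp_pow_single_apply (hL : 1 ≤ L) (hρ0 : 0 < ρ) (hβ : 0 < β) {ψ : Measure ℝ}
    (hψ : IsSpectralMeasure L β ρ ψ) {M : ℝ} (hM : ∀ᵐ x ∂ψ, x ∈ Set.Icc 0 M) {w : Weight}
    {𝒦 : L2 w →L[ℝ] L2 w} (h𝒦 : ∀ (x : L2 w) (k : ℕ), 𝒦 x k = drift L β ρ x k) (t : ℝ) (m : ℕ)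
    (j i : ℕ+) :
    NormedSpace.exp (t • 𝒦) ((𝒦 ^ m) (L2.single w j)) i = potential L ρ i *
      ∫ x, (-x) ^ m * (Real.exp (-(x * t)) * (orthoPoly L β ρ i).eval x *
        (orthoPoly L β ρ j).eval x) ∂ψ := by
  have := hψ.isProbabilityMeasure
  set g : ℝ → ℝ := fun x => (-x) ^ m * ((orthoPoly L β ρ i).eval x * (orthoPoly L β ρ j).eval x)
    with hg
  have hgc : Continuous g := by fun_prop
  have h1 := hasSum_exp_smul_apply 𝒦 t (L2.coord w i) ((𝒦 ^ m) (L2.single w j))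
  obtain ⟨i', hi'⟩ : ∃ k : ℕ, (i : ℕ) = k + 1 := Nat.exists_eq_add_of_le' i.pos
  have hterm (n : ℕ) : t ^ n / n.factorial * L2.coord w i ((𝒦 ^ n) ((𝒦 ^ m) (L2.single w j))) =
      potential L ρ i * ∫ x, (-(x * t)) ^ n / n.factorial * g x ∂ψ := by
    rw [L2.coord_apply, ← mul_apply_eq_comp, ← pow_add, pow_single_apply h𝒦, hi',
      driftPow_eq_integral hL hρ0 hβ hψ hM, mul_left_comm, ← integral_const_mul]
    congr 1
    refine integral_congr_ae (Eventually.of_forall fun x => ?_)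
    simp only [hg, hi', neg_mul_eq_neg_mul, mul_pow, pow_add]
    ring
  simp only [hterm] at h1
  rw [L2.coord_apply] at h1
  have hbound (n : ℕ) : ∫ x, ‖(-(x * t)) ^ n / n.factorial * g x‖ ∂ψ ≤
      (M * |t|) ^ n / n.factorial * ∫ x, ‖g x‖ ∂ψ := by
    rw [← integral_const_mul]
    refine integral_mono_ae (integrable_of_ae_mem_Icc hM (by fun_prop))
      (integrable_of_ae_mem_Icc hM (by fun_prop)) (hM.mono fun x hx => ?_)
    have h0 : (n.factorial : ℝ) ≠ 0 := by positivity
    simp only [norm_mul, norm_div, norm_pow, norm_neg, Real.norm_natCast]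
    rw [Real.norm_of_nonneg hx.1, Real.norm_eq_abs t]
    have := hx.1
    have := hx.2
    gcongr
  have hsum : Summable fun n : ℕ => ∫ x, ‖(-(x * t)) ^ n / n.factorial * g x‖ ∂ψ :=
    Summable.of_nonneg_of_le (fun n => integral_nonneg fun x => norm_nonneg _) hbound
      ((NormedSpace.expSeries_div_summable (M * |t|)).mul_right _)
  have h2 := (hasSum_integral_of_summable_integral_norm
    (fun n => integrable_of_ae_mem_Icc hM (by fun_prop)) hsum).mul_left (potential L ρ i)
  rw [h1.unique h2]
  congr 1
  refine integral_congr_ae (Eventually.of_forall fun x => ?_)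
  have h3 := (NormedSpace.expSeries_div_hasSum_exp (-(x * t))).mul_right (g x)
  rw [← Real.exp_eq_exp_ℝ] at h3
  beta_reduce
  rw [h3.tsum_eq]
  simp only [hg]
  ring

theorem transition_eq_integral (hL : 1 ≤ L) (hρ0 : 0 < ρ) (hβ : 0 < β) {ψ : Measure ℝ}
    (hψ : IsSpectralMeasure L β ρ ψ) {M : ℝ} (hM : ∀ᵐ x ∂ψ, x ∈ Set.Icc 0 M) {w : Weight}
    {𝒦 : L2 w →L[ℝ] L2 w} (h𝒦 : ∀ (x : L2 w) (k : ℕ), 𝒦 x k = drift L β ρ x k) (t : ℝ)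
    (j i : ℕ+) :
    transition L β ρ t j i = potential L ρ i *
      ∫ x, Real.exp (-(x * t)) * (orthoPoly L β ρ i).eval x * (orthoPoly L β ρ j).eval x ∂ψ := by
  rw [← exp_single_apply h𝒦]
  simpa using exp_pow_single_apply hL hρ0 hβ hψ hM h𝒦 t 0 j i

end Spectral

/-! ### Stochastic integrals of smooth deterministic integrands -/

section RiemannStieltjes

variable {E F : Type*} [NormedAddCommGroup E] [NormedSpace ℝ E]
  [NormedAddCommGroup F] [NormedSpace ℝ F] [CompleteSpace F]

/-- Riemann–Stieltjes sums of a continuously differentiable integrand against a continuous path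
converge to the integral defined by partial integration. -/
theorem tendsto_sum_apply_increment {Φ Φ' : ℝ → E →L[ℝ] F} (hΦ : ∀ s, HasDerivAt Φ (Φ' s) s)
    (hΦ' : Continuous Φ') {φ : ℝ → E} (hφ : Continuous φ) {t : ℝ} {N : ℕ → ℕ} {τ : ℕ → ℕ → ℝ}
    (hmono : ∀ n, Monotone (τ n)) (h0 : ∀ n, τ n 0 = 0) (hN : ∀ n, τ n (N n) = t)
    (hmesh : ∀ ε : ℝ, 0 < ε → ∀ᶠ n in atTop, ∀ i < N n, τ n (i + 1) - τ n i < ε) :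
    Tendsto (fun n => ∑ i ∈ Finset.range (N n), Φ (τ n i) (φ (τ n (i + 1)) - φ (τ n i))) atTop
      (𝓝 (Φ t (φ t) - Φ 0 (φ 0) - ∫ s in (0 : ℝ)..t, Φ' s (φ s))) := by
  have ht : 0 ≤ t := by
    rw [← h0 0, ← hN 0]
    exact hmono 0 (Nat.zero_le _)
  have hint (x y : ℝ) : IntervalIntegrable (fun s => Φ' s (φ s)) volume x y :=
    (hΦ'.clm_apply hφ).intervalIntegrable x y
  obtain ⟨C, hC⟩ := (isCompact_Icc (a := 0) (b := t)).exists_bound_of_continuousOn hΦ'.continuousOn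
  have hC0 : 0 ≤ C := (norm_nonneg _).trans (hC 0 ⟨le_rfl, ht⟩)
  -- Summation by parts: on each interval the error is `Φ'` applied to the oscillation of `φ`, which
  -- is uniformly small on `[0, t]`.
  have hdiff (n : ℕ) : ∑ i ∈ Finset.range (N n), Φ (τ n i) (φ (τ n (i + 1)) - φ (τ n i)) -
      (Φ t (φ t) - Φ 0 (φ 0) - ∫ s in (0 : ℝ)..t, Φ' s (φ s)) =
      ∑ i ∈ Finset.range (N n), ∫ s in (τ n i)..(τ n (i + 1)), Φ' s (φ s - φ (τ n (i + 1))) := by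
    have h1 := Finset.sum_range_sub (fun i => Φ (τ n i) (φ (τ n i))) (N n)
    have h2 := intervalIntegral.sum_integral_adjacent_intervals (a := τ n) (n := N n)
      (fun i _ => hint (τ n i) (τ n (i + 1)))
    rw [hN, h0] at h1 h2
    rw [← h1, ← h2, ← Finset.sum_sub_distrib, ← Finset.sum_sub_distrib]
    refine Finset.sum_congr rfl (fun i _ => ?_)
    have h3 : ∫ s in (τ n i)..(τ n (i + 1)), Φ' s (φ (τ n (i + 1))) =
        Φ (τ n (i + 1)) (φ (τ n (i + 1))) - Φ (τ n i) (φ (τ n (i + 1))) := by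
      refine intervalIntegral.integral_eq_sub_of_hasDerivAt
        (f := fun s => Φ s (φ (τ n (i + 1)))) (fun s _ => ?_)
        ((hΦ'.clm_apply continuous_const).intervalIntegrable _ _)
      exact ((hΦ s).clm_apply (hasDerivAt_const s _)).congr_deriv (by simp)
    simp only [map_sub]
    rw [intervalIntegral.integral_sub (hint _ _)
      ((hΦ'.clm_apply continuous_const).intervalIntegrable _ _), h3]
    abel
  rw [Metric.tendsto_nhds]
  intro ε hε
  have hη : 0 < ε / (C * t + 1) := by positivity
  obtain ⟨δ, hδ, hδ'⟩ := Metric.uniformContinuousOn_iff.1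
    (isCompact_Icc.uniformContinuousOn_of_continuous (hφ.continuousOn (s := Set.Icc 0 t)))
    (ε / (C * t + 1)) hη
  filter_upwards [hmesh δ hδ] with n hn
  rw [dist_eq_norm, hdiff]
  have hmem (i : ℕ) (hi : i ≤ N n) : τ n i ∈ Set.Icc 0 t := by
    constructor
    · rw [← h0 n]
      exact hmono n (Nat.zero_le _)
    · rw [← hN n]
      exact hmono n hi
  have hle (i : ℕ) (hi : i ∈ Finset.range (N n)) :
      ‖∫ s in (τ n i)..(τ n (i + 1)), Φ' s (φ s - φ (τ n (i + 1)))‖ ≤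
        C * (ε / (C * t + 1)) * (τ n (i + 1) - τ n i) := by
    rw [Finset.mem_range] at hi
    have hi1 := hmem i hi.le
    have hi2 := hmem (i + 1) hi
    have hii : τ n i ≤ τ n (i + 1) := hmono n (Nat.le_succ i)
    rw [← abs_of_nonneg (sub_nonneg.2 hii)]
    refine intervalIntegral.norm_integral_le_of_norm_le_const (fun s hs => ?_)
    rw [Set.uIoc_of_le hii] at hs
    have hs' : s ∈ Set.Icc 0 t := ⟨hi1.1.trans hs.1.le, hs.2.trans hi2.2⟩
    refine ((Φ' s).le_opNorm _).trans ?_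
    have hd : dist s (τ n (i + 1)) < δ := by
      rw [Real.dist_eq, abs_sub_comm, abs_of_nonneg (by linarith [hs.2])]
      linarith [hn i hi, hs.1]
    have := hδ' s hs' _ hi2 hd
    rw [dist_eq_norm] at this
    exact mul_le_mul (hC s hs') this.le (norm_nonneg _) hC0
  calc ‖∑ i ∈ Finset.range (N n), ∫ s in (τ n i)..(τ n (i + 1)), Φ' s (φ s - φ (τ n (i + 1)))‖
      ≤ ∑ i ∈ Finset.range (N n), C * (ε / (C * t + 1)) * (τ n (i + 1) - τ n i) :=
        norm_sum_le_of_le _ hle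
    _ = C * t / (C * t + 1) * ε := by
        rw [← Finset.mul_sum, Finset.sum_range_sub, hN, h0]
        ring
    _ < ε := by
        have : C * t / (C * t + 1) < 1 := by
          rw [div_lt_one (by positivity)]
          linarith
        exact mul_lt_of_lt_one_left hε this

variable {Ω : Type*} [MeasurableSpace Ω]

/-- The sums converge along every continuous path, and almost sure convergence implies convergence
in probability. -/
theorem isStochasticIntegral_of_hasDerivAt {μ : Measure Ω} [IsFiniteMeasure μ]
    {Φ Φ' : ℝ → E →L[ℝ] F} (hΦ : ∀ s, HasDerivAt Φ (Φ' s) s) (hΦ' : Continuous Φ')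
    {W : ℝ≥0 → Ω → E} (hW : ∀ t, AEStronglyMeasurable (W t) μ)
    (hWc : ∀ᵐ ω ∂μ, Continuous fun t => W t ω) (t : ℝ≥0) :
    IsStochasticIntegral μ (fun s : ℝ≥0 => Φ s) W t
      (fun ω => Φ t (W t ω) - Φ 0 (W 0 ω) - ∫ s in (0 : ℝ)..t, Φ' s (W s.toNNReal ω)) := by
  intro N τ hmono h0 hN hmesh
  refine tendstoInMeasure_of_tendsto_ae (fun n => ?_) ?_
  · exact Finset.aestronglyMeasurable_fun_sum _ fun i _ =>
      (Φ (τ n i)).continuous.comp_aestronglyMeasurable ((hW _).sub (hW _))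
  · filter_upwards [hWc] with ω hω
    have h := tendsto_sum_apply_increment hΦ hΦ' (φ := fun s : ℝ => W s.toNNReal ω)
      (hω.comp continuous_real_toNNReal) (t := t) (N := N) (τ := fun n i => (τ n i : ℝ))
      (fun n => NNReal.coe_mono.comp (hmono n)) (fun n => by simp [h0]) (fun n => by simp [hN])
      hmesh
    simpa using h

end RiemannStieltjes

/-! ### Measurability -/

section Measurability

variable {Ω : Type*} {m m₀ : MeasurableSpace Ω} {μ : Measure[m₀] Ω}

/-- The σ-algebra `m` need not be that of `μ`. The limit is taken of `m`-measurable versions, which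
agree almost everywhere with the given functions. -/
theorem aestronglyMeasurable_of_ae_tendsto {E : Type*} [TopologicalSpace E]
    [Nonempty E] [TopologicalSpace.IsCompletelyMetrizableSpace E] {f : ℕ → Ω → E} {g : Ω → E}
    (hf : ∀ n, AEStronglyMeasurable[m] (f n) μ)
    (hfg : ∀ᵐ ω ∂μ, Tendsto (fun n => f n ω) atTop (𝓝 (g ω))) :
    AEStronglyMeasurable[m] g μ := by
  choose f' hf' hff' using hf
  refine ⟨fun ω => limUnder atTop fun n => f' n ω,
    @StronglyMeasurable.limUnder _ _ _ m _ _ _ _ _ _ _ hf', ?_⟩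
  filter_upwards [hfg, ae_all_iff.2 hff'] with ω h1 h2
  simp only [h2] at h1
  exact h1.limUnder_eq.symm

theorem aestronglyMeasurable_finset_sum {ι E : Type*} [NormedAddCommGroup E] {f : ι → Ω → E}
    (s : Finset ι) (hf : ∀ i ∈ s, AEStronglyMeasurable[m] (f i) μ) :
    AEStronglyMeasurable[m] (fun ω => ∑ i ∈ s, f i ω) μ := by
  classical
  induction s using Finset.induction_on with
  | empty =>
    simp only [Finset.sum_empty]
    exact aestronglyMeasurable_const
  | insert i s hi ih =>
    simp only [Finset.sum_insert hi]
    exact (hf i (Finset.mem_insert_self i s)).add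
      (ih fun j hj => hf j (Finset.mem_insert_of_mem hj))

theorem L2.aestronglyMeasurable_of_apply {w : Weight} {X : Ω → L2 w} {c : ℕ+ → Ω → ℝ}
    (hc : ∀ k, AEStronglyMeasurable[m] (c k) μ) (hX : ∀ᵐ ω ∂μ, ∀ k : ℕ+, X ω k = c k ω) :
    AEStronglyMeasurable[m] X μ := by
  refine aestronglyMeasurable_of_ae_tendsto
    (m := m) (f := fun n ω => ∑ k ∈ Finset.range n, c k.succPNat ω • L2.single w k.succPNat) (fun n => ?_) ?_
  · refine aestronglyMeasurable_finset_sum _ fun k _ => ?_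
    exact (hc _).smul_const _
  · filter_upwards [hX] with ω hω
    have h := L2.hasSum_single (X ω)
    rw [← Equiv.pnatEquivNat.symm.hasSum_iff] at h
    simp only [hω] at h
    exact h.tendsto_sum_nat

end Measurability

/-! ### Chaining bound for Brownian paths -/

/-- Chaining: a dyadic point of level `n + 1` is either of level `n` or one step to the right of
such a point, so passing to the next level costs at most `a r^(n+1)`. -/
theorem abs_dyadic_le {y : ℝ → ℝ} (h0 : y 0 = 0) {T a r : ℝ} (ha : 0 ≤ a) (hr0 : 0 ≤ r)
    (h : ∀ n : ℕ, ∀ i : ℕ, i < 2 ^ n → |y (T * ((i + 1 : ℕ) / 2 ^ n)) - y (T * (i / 2 ^ n))| ≤ a * r ^ n)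
    (n : ℕ) : ∀ i : ℕ, i ≤ 2 ^ n → |y (T * (i / 2 ^ n))| ≤ a * ∑ m ∈ Finset.range (n + 1), r ^ m := by
  induction n with
  | zero =>
    intro i hi
    have h1 := h 0 0 (by norm_num)
    rcases Nat.le_one_iff_eq_zero_or_eq_one.1 (by simpa using hi) with rfl | rfl
    · simpa [h0] using ha
    · simpa [h0] using h1
  | succ n ih =>
    intro i hi
    rw [Finset.sum_range_succ, mul_add]
    have hr : 0 ≤ a * r ^ (n + 1) := by positivity
    have heven (k : ℕ) : T * ((2 * k : ℕ) / 2 ^ (n + 1)) = T * (k / 2 ^ n) := by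
      push_cast
      rw [pow_succ]
      field_simp
    rw [pow_succ] at hi
    rcases Nat.even_or_odd' i with ⟨k, rfl | rfl⟩
    · rw [heven]
      linarith [ih k (by omega)]
    · have h1 := h (n + 1) (2 * k) (by rw [pow_succ]; omega)
      rw [heven] at h1
      have h2 := ih k (by omega)
      have h3 := abs_add_le (y (T * ((2 * k + 1 : ℕ) / 2 ^ (n + 1))) - y (T * (k / 2 ^ n)))
        (y (T * (k / 2 ^ n)))
      rw [sub_add_cancel] at h3
      linarith

theorem abs_le_of_dyadic_increments {y : ℝ → ℝ} (hy : Continuous y) (h0 : y 0 = 0) {T a r : ℝ}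
    (hT : 0 < T) (ha : 0 ≤ a) (hr0 : 0 ≤ r) (hr1 : r < 1)
    (h : ∀ n : ℕ, ∀ i : ℕ, i < 2 ^ n → |y (T * ((i + 1 : ℕ) / 2 ^ n)) - y (T * (i / 2 ^ n))| ≤ a * r ^ n)
    {t : ℝ} (ht0 : 0 ≤ t) (htT : t ≤ T) : |y t| ≤ a * (1 - r)⁻¹ := by
  have h1 : Tendsto (fun n : ℕ => T * ((⌊t / T * 2 ^ n⌋₊ : ℝ) / 2 ^ n)) atTop (𝓝 t) := by
    have h2 := (tendsto_nat_floor_mul_div_atTop (R := ℝ) (a := t / T) (by positivity)).comp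
      (tendsto_pow_atTop_atTop_of_one_lt (r := (2 : ℝ)) one_lt_two)
    have h3 := h2.const_mul T
    rwa [mul_div_cancel₀ t hT.ne'] at h3
  refine le_of_tendsto ((hy.tendsto t).comp h1).abs (Eventually.of_forall fun n => ?_)
  refine (abs_dyadic_le h0 ha hr0 h n _ ?_).trans ?_
  · refine Nat.floor_le_of_le ?_
    push_cast
    exact mul_le_of_le_one_left (by positivity) ((div_le_one hT).2 htT)
  · gcongr
    rw [← tsum_geometric_of_lt_one hr0 hr1]
    exact (summable_geometric_of_lt_one hr0 hr1).sum_le_tsum _ (fun i _ => by positivity)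

/-- A weighted sum of the fourth powers of the dyadic increments of a path on `[0, T]`. -/
def dyadicEnergy (T : ℝ) (y : ℝ → ℝ) : ℝ≥0∞ :=
  ∑' n : ℕ, ENNReal.ofReal (((9 / 10 : ℝ) ^ 4)⁻¹ ^ n) * ∑ i ∈ Finset.range (2 ^ n),
    ENNReal.ofReal ((y (T * ((i + 1 : ℕ) / 2 ^ n)) - y (T * (i / 2 ^ n))) ^ 4)

/-- With energy `E`, an increment at level `n` is at most `E^(1/4) (9/10)^n`. Chaining gives `|y| ≤
10 E^(1/4)`, and `q ≤ 1 + q²` with `q = (10 E^(1/4))²` makes the bound linear in `E`, ready for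
taking expectations. -/
theorem sq_le_dyadicEnergy {y : ℝ → ℝ} (hy : Continuous y) (h0 : y 0 = 0) {T : ℝ} (hT : 0 < T)
    (hE : dyadicEnergy T y ≠ ∞) {t : ℝ} (ht0 : 0 ≤ t) (htT : t ≤ T) :
    y t ^ 2 ≤ 1 + 10 ^ 4 * (dyadicEnergy T y).toReal := by
  set a := √√(dyadicEnergy T y).toReal with ha
  have ha4 : a ^ 4 = (dyadicEnergy T y).toReal := by
    rw [show a ^ 4 = (a ^ 2) ^ 2 by ring, Real.sq_sqrt (Real.sqrt_nonneg _),
      Real.sq_sqrt ENNReal.toReal_nonneg]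
  have hinc (n i : ℕ) (hi : i < 2 ^ n) :
      |y (T * ((i + 1 : ℕ) / 2 ^ n)) - y (T * (i / 2 ^ n))| ≤ a * (9 / 10) ^ n := by
    set δ := y (T * ((i + 1 : ℕ) / 2 ^ n)) - y (T * (i / 2 ^ n)) with hδ
    have h1 : ENNReal.ofReal (((9 / 10 : ℝ) ^ 4)⁻¹ ^ n) * ENNReal.ofReal (δ ^ 4) ≤
        dyadicEnergy T y := by
      refine le_trans ?_ (ENNReal.le_tsum n)
      gcongr
      exact Finset.single_le_sum (f := fun i : ℕ => ENNReal.ofReal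
        ((y (T * ((i + 1 : ℕ) / 2 ^ n)) - y (T * (i / 2 ^ n))) ^ 4)) (fun _ _ => zero_le)
        (Finset.mem_range.2 hi)
    rw [← ENNReal.ofReal_mul (by positivity)] at h1
    have h2 := (ENNReal.ofReal_le_iff_le_toReal hE).1 h1
    rw [← ha4, inv_pow, inv_mul_le_iff₀ (by positivity)] at h2
    refine le_of_pow_le_pow_left₀ (n := 4) (by norm_num) (by positivity) ?_
    rw [Even.pow_abs (by decide), mul_pow, ← pow_mul, mul_comm n 4, pow_mul, mul_comm]
    exact h2
  have h3 := abs_le_of_dyadic_increments hy h0 hT (by positivity) (by norm_num) (by norm_num)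
    hinc ht0 htT
  norm_num at h3
  have h4 : y t ^ 2 ≤ (a * 10) ^ 2 := by
    rw [← sq_abs]
    gcongr
  rw [← ha4]
  nlinarith [sq_nonneg ((a * 10) ^ 2 - 1), sq_nonneg ((a * 10) ^ 2)]

section Brownian

variable {Ω : Type*} [MeasurableSpace Ω] {μ : Measure Ω}

theorem lintegral_pow_four_gaussianReal (v : ℝ≥0) :
    ∫⁻ x, ENNReal.ofReal (x ^ 4) ∂gaussianReal 0 v =
      (v : ℝ≥0∞) ^ 2 * ∫⁻ x, ENNReal.ofReal (x ^ 4) ∂gaussianReal 0 1 := by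
  have h : gaussianReal 0 v = (gaussianReal 0 1).map (√v * ·) := by
    rw [gaussianReal_map_const_mul]
    congr 1
    · simp
    · ext
      simp
  rw [h, lintegral_map (by fun_prop) (by fun_prop), ← lintegral_const_mul _ (by fun_prop)]
  refine lintegral_congr fun x => ?_
  rw [mul_pow, show √(v : ℝ) ^ 4 = (√(v : ℝ) ^ 2) ^ 2 by ring, Real.sq_sqrt v.coe_nonneg,
    ENNReal.ofReal_mul (by positivity), ENNReal.ofReal_pow v.coe_nonneg, ENNReal.ofReal_coe_nnreal]

theorem lintegral_pow_four_gaussianReal_ne_top :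
    ∫⁻ x, ENNReal.ofReal (x ^ 4) ∂gaussianReal 0 1 ≠ ∞ := by
  have h := (memLp_id_gaussianReal (μ := 0) (v := 1) 4).integrable_norm_pow (by norm_num)
  have h' : Integrable (fun x : ℝ => x ^ 4) (gaussianReal 0 1) := by
    refine h.congr (Eventually.of_forall fun x => ?_)
    simp [Even.pow_abs (show Even 4 by decide)]
  exact (lintegral_ofReal_ne_top_iff_integrable h'.aestronglyMeasurable
    (Eventually.of_forall fun x => by positivity)).2 h'

theorem aemeasurable_dyadicEnergy {X : ℝ≥0 → Ω → ℝ} (hX : ∀ t, AEMeasurable (X t) μ) (T : ℝ) :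
    AEMeasurable (fun ω => dyadicEnergy T fun s => X s.toNNReal ω) μ := by
  refine AEMeasurable.tsum fun n => AEMeasurable.const_mul ?_ _
  exact Finset.aemeasurable_fun_sum _ fun i _ => (((hX _).sub (hX _)).pow_const 4).ennreal_ofReal

/-- Each of the `2^n` increments has fourth moment `T² 4^(-n)` times the standard one. With the
weight `(10/9)^(4n)` the ratio is `(10/9)^4 / 2 = 5000/6561 < 1`. The value is the same for every
Brownian motion, hence uniform over the coordinates of the noise. -/
theorem lintegral_dyadicEnergy {X : ℝ≥0 → Ω → ℝ} (hX : IsPreBrownianReal X μ) {T : ℝ}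
    (hT : 0 ≤ T) : ∫⁻ ω, dyadicEnergy T (fun s => X s.toNNReal ω) ∂μ =
      ∑' n : ℕ, ENNReal.ofReal (T ^ 2 * (5000 / 6561) ^ n) *
        ∫⁻ x, ENNReal.ofReal (x ^ 4) ∂gaussianReal 0 1 := by
  have hm (s t : ℝ≥0) : AEMeasurable (fun ω => ENNReal.ofReal ((X s ω - X t ω) ^ 4)) μ :=
    (((hX.aemeasurable s).sub (hX.aemeasurable t)).pow_const 4).ennreal_ofReal
  unfold dyadicEnergy
  rw [lintegral_tsum fun n => (Finset.aemeasurable_fun_sum _ fun i _ => hm _ _).const_mul _]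
  refine tsum_congr fun n => ?_
  rw [lintegral_const_mul'' _ (Finset.aemeasurable_fun_sum _ fun i _ => hm _ _),
    lintegral_finsetSum' _ fun i _ => hm _ _]
  have hinc (i : ℕ) : ∫⁻ ω, ENNReal.ofReal ((X (T * ((i + 1 : ℕ) / 2 ^ n)).toNNReal ω -
      X (T * (i / 2 ^ n)).toNNReal ω) ^ 4) ∂μ =
      ENNReal.ofReal ((T / 2 ^ n) ^ 2) * ∫⁻ x, ENNReal.ofReal (x ^ 4) ∂gaussianReal 0 1 := by
    have hlaw := hX.hasLaw_sub (T * ((i + 1 : ℕ) / 2 ^ n)).toNNReal (T * (i / 2 ^ n)).toNNReal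
    set v := nndist ((T * ((i + 1 : ℕ) / 2 ^ n)).toNNReal).1 ((T * (i / 2 ^ n)).toNNReal).1 with hv
    have hv' : (v : ℝ) = T / 2 ^ n := by
      rw [hv, coe_nndist]
      change dist ((T * ((i + 1 : ℕ) / 2 ^ n)).toNNReal : ℝ) ((T * (i / 2 ^ n)).toNNReal : ℝ) = _
      rw [Real.coe_toNNReal _ (by positivity), Real.coe_toNNReal _ (by positivity), Real.dist_eq,
        ← mul_sub, ← sub_div]
      push_cast
      rw [add_sub_cancel_left, mul_one_div, abs_of_nonneg (by positivity)]
    have h1 := lintegral_pow_four_gaussianReal v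
    rw [← hlaw.map_eq, lintegral_map' (by fun_prop) hlaw.aemeasurable] at h1
    have h2 : (v : ℝ≥0∞) ^ 2 = ENNReal.ofReal ((T / 2 ^ n) ^ 2) := by
      rw [← hv', ENNReal.ofReal_pow v.coe_nonneg, ENNReal.ofReal_coe_nnreal]
    rw [← h2, ← h1]
    rfl
  simp only [hinc, Finset.sum_const, Finset.card_range, nsmul_eq_mul]
  rw [← mul_assoc, ← mul_assoc, ← ENNReal.ofReal_natCast, ← ENNReal.ofReal_mul (by positivity),
    ← ENNReal.ofReal_mul (by positivity)]
  congr 2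
  have h4 : (5000 / 6561 : ℝ) ^ n = ((9 / 10 : ℝ) ^ 4)⁻¹ ^ n * (2 ^ n * (1 / 2 ^ n) ^ 2) := by
    have : (2 : ℝ) ^ n * (1 / 2 ^ n) ^ 2 = (1 / 2) ^ n := by
      simp only [one_div_pow]
      field_simp
    rw [this, ← mul_pow]
    norm_num
  rw [h4]
  push_cast
  ring

theorem exists_lintegral_dyadicEnergy_le {T : ℝ} (hT : 0 ≤ T) :
    ∃ C : ℝ≥0∞, C ≠ ∞ ∧ ∀ X : ℝ≥0 → Ω → ℝ, IsPreBrownianReal X μ →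
      ∫⁻ ω, dyadicEnergy T (fun s => X s.toNNReal ω) ∂μ = C := by
  refine ⟨_, ?_, fun X hX => lintegral_dyadicEnergy hX hT⟩
  rw [ENNReal.tsum_mul_right]
  refine ENNReal.mul_ne_top ?_ lintegral_pow_four_gaussianReal_ne_top
  exact ((summable_geometric_of_lt_one (by norm_num) (by norm_num)).mul_left _).tsum_ofReal_ne_top

end Brownian

/-! ### The driving noise as a continuous process in `L₂(w)` -/

section NoisePath

/-- Coordinatewise continuity becomes norm continuity by dominated convergence; on `[0, T]` the
squared coordinates of a difference, divided by the weight, are at most `4 u k`. -/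
theorem L2.exists_continuous_path (w : Weight) {b : ℕ → ℝ≥0 → ℝ} (hb0 : ∀ t, b 0 t = 0)
    (hb : ∀ k, Continuous (b k))
    (hu : ∀ T : ℕ, ∃ u : ℕ → ℝ, Summable u ∧
      ∀ (k : ℕ) (t : ℝ≥0), t ≤ T → b (k + 1) t ^ 2 / w (k + 1) ≤ u k) :
    ∃ W : ℝ≥0 → L2 w, Continuous W ∧ ∀ t k, W t k = b k t := by
  have hw (k : ℕ) : 0 < w (k + 1) := w.pos _ (by omega)
  have hmem (t : ℝ≥0) : Summable fun k => b (k + 1) t ^ 2 / w (k + 1) := by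
    obtain ⟨n, hn⟩ := exists_nat_ge t
    obtain ⟨u, hus, hu'⟩ := hu n
    exact Summable.of_nonneg_of_le (fun k => div_nonneg (sq_nonneg _) (hw k).le)
      (fun k => hu' k t hn) hus
  let W : ℝ≥0 → L2 w := fun t => ⟨fun k => b k t, hb0 t, hmem t⟩
  refine ⟨W, continuous_iff_continuousAt.2 fun t₀ => ?_, fun t k => rfl⟩
  obtain ⟨n, hn⟩ := exists_nat_gt t₀
  obtain ⟨u, hus, hu'⟩ := hu n
  have h1 : Tendsto (fun t => ‖W t - W t₀‖ ^ 2) (𝓝 t₀) (𝓝 0) := by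
    have h2 : Tendsto (fun t => ∑' k, (b (k + 1) t - b (k + 1) t₀) ^ 2 / w (k + 1)) (𝓝 t₀)
        (𝓝 (∑' _ : ℕ, (0 : ℝ))) := by
      refine tendsto_tsum_of_dominated_convergence (bound := fun k => 4 * u k) (hus.mul_left 4)
        (fun k => ?_) ?_
      · have h3 : Continuous fun t => (b (k + 1) t - b (k + 1) t₀) ^ 2 / w (k + 1) :=
          (((hb (k + 1)).sub continuous_const).pow 2).div_const _
        simpa using h3.tendsto t₀
      · filter_upwards [Iic_mem_nhds hn] with t ht k
        have h4 := hu' k t ht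
        have h5 := hu' k t₀ hn.le
        rw [Real.norm_of_nonneg (div_nonneg (sq_nonneg _) (hw k).le)]
        calc (b (k + 1) t - b (k + 1) t₀) ^ 2 / w (k + 1)
            ≤ (2 * (b (k + 1) t ^ 2 + b (k + 1) t₀ ^ 2)) / w (k + 1) := by
              have := hw k
              gcongr
              nlinarith [sq_nonneg (b (k + 1) t + b (k + 1) t₀)]
          _ = 2 * (b (k + 1) t ^ 2 / w (k + 1) + b (k + 1) t₀ ^ 2 / w (k + 1)) := by ring
          _ ≤ 4 * u k := by linarith
    rw [tsum_zero] at h2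
    refine h2.congr fun t => ?_
    rw [L2.norm_sq_eq]
    rfl
  refine tendsto_iff_norm_sub_tendsto_zero.2 ?_
  have h6 := h1.sqrt
  simpa [Real.sqrt_sq (norm_nonneg _)] using h6

variable {L : ℕ} {β ρ : ℝ} {Ω : Type*} [MeasurableSpace Ω] {μ : Measure Ω}

theorem stablePoint_succ_lt (hL : 1 ≤ L) (hρ0 : 0 < ρ) (hρ1 : ρ < 1) (k : ℕ) :
    stablePoint L ρ (k + 1) < stablePoint L ρ k := by
  rw [stablePoint, stablePoint, Finset.sum_range_succ]
  exact pow_lt_pow_right_of_lt_one₀ hρ0 hρ1 (lt_add_of_pos_right _ (pow_pos (by omega) _))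

theorem noiseVar_pos (hL : 1 ≤ L) (hρ0 : 0 < ρ) (hρ1 : ρ < 1) (hβ : 0 < β) (k : ℕ) :
    0 < noiseVar L β ρ k :=
  mul_pos (by linarith) (sub_pos.2 (stablePoint_succ_lt hL hρ0 hρ1 k))

theorem summable_noiseVar_div (hL : 1 ≤ L) (hρ0 : 0 < ρ) (hρ1 : ρ < 1) (hβ : 0 < β) {w : Weight}
    (hw : StablePointSummable L ρ w) :
    Summable fun k => noiseVar L β ρ (k + 1) / w (k + 1) := by
  have hwp (k : ℕ) : 0 < w (k + 1) := w.pos _ (by omega)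
  refine Summable.of_nonneg_of_le
    (fun k => div_nonneg (noiseVar_pos hL hρ0 hρ1 hβ _).le (hwp k).le) (fun k => ?_)
    (hw.mul_left (2 * β))
  rw [← mul_div_assoc]
  have := hwp k
  have := stablePoint_pos L hρ0 (k + 2)
  rw [abs_of_pos (stablePoint_pos L hρ0 _)]
  unfold noiseVar
  gcongr
  linarith

/-- With `c k` the variance over the weight and `E_k` the energy of the normalized coordinate, the
expectation of `∑ c k * E_k` is a constant times `∑ c k`, hence finite. So `c k * (1 + 10^4 E_k)` is
almost surely a summable bound for the weighted squares on `[0, T]`. -/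
theorem exists_noise_path (hL : 1 ≤ L) (hρ0 : 0 < ρ) (hρ1 : ρ < 1) (hβ : 0 < β) {w : Weight}
    (hw : StablePointSummable L ρ w) {B : ℕ → ℝ≥0 → Ω → ℝ} (hB : IsDrivingNoise L β ρ μ B) :
    ∃ W : ℝ≥0 → Ω → L2 w, (∀ ω, Continuous fun t => W t ω) ∧ (∀ ω, W 0 ω = 0) ∧
      ∀ᵐ ω ∂μ, ∀ t k, W t ω k = B k t ω := by
  have hwp (k : ℕ) : 0 < w (k + 1) := w.pos _ (by omega)
  have hv := noiseVar_pos (L := L) hL hρ0 hρ1 hβ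
  set X : ℕ → ℝ≥0 → Ω → ℝ := fun k t ω => B (k + 1) t ω / √(noiseVar L β ρ (k + 1)) with hX
  have hXB (k : ℕ) : IsBrownianReal (X k) μ := hB.brownian (k + 1) (by omega)
  set c : ℕ → ℝ := fun k => noiseVar L β ρ (k + 1) / w (k + 1) with hc
  have hc0 (k : ℕ) : 0 < c k := div_pos (hv _) (hwp k)
  have hcs : Summable c := summable_noiseVar_div hL hρ0 hρ1 hβ hw
  -- The length is `T + 1` because chaining needs an interval of positive length.
  have henergy (T : ℕ) : ∀ᵐ ω ∂μ, ∑' k, ENNReal.ofReal (c k) *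
      dyadicEnergy (T + 1 : ℕ) (fun s => X k s.toNNReal ω) < ∞ := by
    obtain ⟨C, hC, hC'⟩ := exists_lintegral_dyadicEnergy_le (μ := μ) (T := (T + 1 : ℕ))
      (by positivity)
    have hm (k : ℕ) := (aemeasurable_dyadicEnergy (fun t => (hXB k).aemeasurable t)
      ((T + 1 : ℕ) : ℝ))
    refine ae_lt_top' (AEMeasurable.tsum fun k => (hm k).const_mul _) ?_
    rw [lintegral_tsum fun k => (hm k).const_mul _]
    simp only [lintegral_const_mul'' _ (hm _), hC' _ (hXB _).toIsPreBrownianReal]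
    rw [ENNReal.tsum_mul_right]
    exact ENNReal.mul_ne_top hcs.tsum_ofReal_ne_top hC
  have hgood : ∀ᵐ ω ∂μ, ∃ W : ℝ≥0 → L2 w, Continuous W ∧ W 0 = 0 ∧ ∀ t k, W t k = B k t ω := by
    filter_upwards [ae_all_iff.2 henergy, ae_all_iff.2 fun k => (hXB k).cont,
      ae_all_iff.2 fun k => (hXB k).eval_zero_ae_eq_zero] with ω h1 h2 h3
    have hBX (k : ℕ) (t : ℝ≥0) : B (k + 1) t ω = √(noiseVar L β ρ (k + 1)) * X k t ω :=
      (mul_div_cancel₀ _ (Real.sqrt_pos.2 (hv _)).ne').symm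
    have hBc (k : ℕ) : Continuous fun t => B k t ω := by
      cases k with
      | zero => simpa only [hB.zero] using continuous_const
      | succ k =>
        simp only [hBX]
        exact continuous_const.mul (h2 k)
    obtain ⟨W, hW, hW'⟩ := L2.exists_continuous_path w (b := fun k t => B k t ω)
      (fun t => hB.zero t ω) hBc (fun T => by
        set e : ℕ → ℝ≥0∞ := fun k => dyadicEnergy (T + 1 : ℕ) (fun s => X k s.toNNReal ω) with he
        refine ⟨fun k => c k * (1 + 10 ^ 4 * (e k).toReal), ?_, fun k t ht => ?_⟩
        · have h4 := ENNReal.summable_toReal (h1 T).ne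
          simp only [ENNReal.toReal_mul, ENNReal.toReal_ofReal (hc0 _).le] at h4
          refine (hcs.add (h4.mul_left (10 ^ 4))).congr fun k => ?_
          ring
        · have h5 : e k ≠ ∞ := by
            intro h6
            refine (ENNReal.ne_top_of_tsum_ne_top (h1 T).ne k) ?_
            change ENNReal.ofReal (c k) * e k = ∞
            rw [h6, ENNReal.mul_top (ENNReal.ofReal_pos.2 (hc0 k)).ne']
          have h7 := sq_le_dyadicEnergy (y := fun s => X k s.toNNReal ω)
            ((h2 k).comp continuous_real_toNNReal) (by simpa using h3 k)
            (T := (T + 1 : ℕ)) (by positivity) h5 (t := t) t.2 (by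
              have : (t : ℝ) ≤ T := by exact_mod_cast ht
              push_cast
              linarith)
          rw [Real.toNNReal_coe] at h7
          rw [hBX, mul_pow, Real.sq_sqrt (hv _).le, mul_div_right_comm]
          exact mul_le_mul_of_nonneg_left h7 (hc0 k).le)
    refine ⟨W, hW, L2.ext fun k => ?_, hW'⟩
    rw [hW']
    obtain ⟨k', hk⟩ : ∃ n : ℕ, (k : ℕ) = n + 1 := Nat.exists_eq_add_of_le' k.pos
    rw [hk, hBX, h3, mul_zero]
    rfl
  classical
  -- On the exceptional set the path is `0`, so continuity and the initial value hold for every `ω`;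
  -- only agreement with `B` is almost sure.
  refine ⟨fun t ω => if h : ∃ W : ℝ≥0 → L2 w, Continuous W ∧ W 0 = 0 ∧ ∀ t k, W t k = B k t ω
    then h.choose t else 0, fun ω => ?_, fun ω => ?_, ?_⟩
  · by_cases h : ∃ W : ℝ≥0 → L2 w, Continuous W ∧ W 0 = 0 ∧ ∀ t k, W t k = B k t ω
    · simp only [dif_pos h]
      exact h.choose_spec.1
    · simp only [dif_neg h]
      exact continuous_const
  · by_cases h : ∃ W : ℝ≥0 → L2 w, Continuous W ∧ W 0 = 0 ∧ ∀ t k, W t k = B k t ω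
    · simp only [dif_pos h]
      exact h.choose_spec.2.1
    · simp only [dif_neg h]
  · filter_upwards [hgood] with ω h
    simp only [dif_pos h]
    exact h.choose_spec.2.2

end NoisePath

/-! ### Linear equations with additive continuous forcing -/

section LinearEquation

variable {E : Type*} [NormedAddCommGroup E] [NormedSpace ℝ E] [CompleteSpace E]

/-- Bootstrapping: an integrable solution equals a primitive, so it is continuous, so the primitive
is differentiable and the solution satisfies the linear equation with initial value `0`. -/
theorem eq_zero_of_eq_integral (K : E →L[ℝ] E) {z : ℝ≥0 → E}
    (hint : ∀ T : ℝ≥0, IntervalIntegrable (fun s : ℝ => z s.toNNReal) volume 0 T)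
    (hz : ∀ t : ℝ≥0, z t = ∫ s in (0 : ℝ)..t, K (z s.toNNReal)) (t : ℝ≥0) : z t = 0 := by
  have hKint (T : ℝ≥0) : IntervalIntegrable (fun s : ℝ => K (z s.toNNReal)) volume 0 T :=
    ⟨K.integrable_comp (hint T).1, K.integrable_comp (hint T).2⟩
  have hcont : Continuous fun s : ℝ => z s.toNNReal := by
    rw [continuous_iff_continuousAt]
    intro s
    set T : ℝ≥0 := s.toNNReal + 1 with hT
    have h1 : ContinuousOn (fun u : ℝ => ∫ r in (0 : ℝ)..u, K (z r.toNNReal)) (Set.Icc 0 T) := by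
      have h := intervalIntegral.continuousOn_primitive_interval (μ := volume) (a := 0)
        (b := (T : ℝ)) (f := fun r : ℝ => K (z r.toNNReal)) (by
          rw [Set.uIcc_of_le T.coe_nonneg, integrableOn_Icc_iff_integrableOn_Ioc,
            ← intervalIntegrable_iff_integrableOn_Ioc_of_le T.coe_nonneg]
          exact hKint T)
      rwa [Set.uIcc_of_le T.coe_nonneg] at h
    have h2 : ContinuousOn (fun u : ℝ => ∫ r in (0 : ℝ)..(u.toNNReal : ℝ), K (z r.toNNReal))
        (Set.Iic (T : ℝ)) := by
      refine h1.comp (NNReal.continuous_coe.comp continuous_real_toNNReal).continuousOn ?_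
      intro u hu
      exact ⟨NNReal.coe_nonneg _, by exact_mod_cast Real.toNNReal_le_iff_le_coe.2 hu⟩
    have h3 : ContinuousAt (fun u : ℝ => ∫ r in (0 : ℝ)..(u.toNNReal : ℝ), K (z r.toNNReal)) s := by
      refine h2.continuousAt (Iic_mem_nhds ?_)
      rw [hT, NNReal.coe_add, NNReal.coe_one]
      linarith [Real.le_coe_toNNReal s]
    exact h3.congr (Eventually.of_forall fun u => (hz u.toNNReal).symm)
  have hKc : Continuous fun s : ℝ => K (z s.toNNReal) := K.continuous.comp hcont
  have hode (s : ℝ) (hs : 0 ≤ s) :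
      HasDerivWithinAt (fun s : ℝ => z s.toNNReal) (K (z s.toNNReal)) (Set.Ici 0) s := by
    have h := intervalIntegral.integral_hasDerivAt_right (hKc.intervalIntegrable 0 s)
      (hKc.stronglyMeasurableAtFilter _ _) hKc.continuousAt
    refine h.hasDerivWithinAt.congr (fun u hu => ?_) ?_
    · rw [hz, Real.coe_toNNReal _ hu]
    · rw [hz, Real.coe_toNNReal _ hs]
  have h0 : z 0 = 0 := by
    rw [hz 0]
    simp
  have h := eq_exp_smul_apply_of_hasDerivWithinAt K hode t.coe_nonneg
  simp only [Real.toNNReal_coe, Real.toNNReal_zero, h0, map_zero] at h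
  exact h

/-- The variation of constants formula for `ẏ = K y + φ̇`, `y(0) = z₀ + φ(0)`, after partial
integration, for `φ` with `φ(0) = 0`. -/
def mildSolution (K : E →L[ℝ] E) (z₀ : E) (φ : ℝ → E) (t : ℝ) : E :=
  NormedSpace.exp (t • K) z₀ +
    (φ t + ∫ s in (0 : ℝ)..t, NormedSpace.exp ((t - s) • K) (K (φ s)))

theorem continuous_exp_smul (K : E →L[ℝ] E) :
    Continuous fun t : ℝ => NormedSpace.exp (t • K) :=
  continuous_iff_continuousAt.2 fun t => (hasDerivAt_exp_smul_const K t).continuousAt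

/-- With `e^{tK}` pulled out, `t` is only the endpoint of the integral, and the fundamental theorem
of calculus applies. -/
theorem mildSolution_eq (K : E →L[ℝ] E) (z₀ : E) {φ : ℝ → E} (hφ : Continuous φ) (t : ℝ) :
    mildSolution K z₀ φ t = φ t + NormedSpace.exp (t • K)
      (z₀ + ∫ s in (0 : ℝ)..t, NormedSpace.exp (-s • K) (K (φ s))) := by
  have hc : Continuous fun s : ℝ => NormedSpace.exp (-s • K) (K (φ s)) :=
    ((continuous_exp_smul K).comp continuous_neg).clm_apply (K.continuous.comp hφ)
  rw [mildSolution, map_add, ← ContinuousLinearMap.intervalIntegral_comp_comm _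
    (hc.intervalIntegrable 0 t), add_left_comm]
  congr 2
  refine intervalIntegral.integral_congr fun s _ => ?_
  rw [sub_eq_add_neg, exp_smul_add]
  rfl

/-- The path `φ` is merely continuous; subtracting it leaves the differentiable part of the
solution. -/
theorem hasDerivAt_mildSolution_sub (K : E →L[ℝ] E) (z₀ : E) {φ : ℝ → E} (hφ : Continuous φ)
    (t : ℝ) :
    HasDerivAt (fun s => mildSolution K z₀ φ s - φ s) (K (mildSolution K z₀ φ t)) t := by
  have hc : Continuous fun s : ℝ => NormedSpace.exp (-s • K) (K (φ s)) :=
    ((continuous_exp_smul K).comp continuous_neg).clm_apply (K.continuous.comp hφ)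
  have h1 := intervalIntegral.integral_hasDerivAt_right (hc.intervalIntegrable 0 t)
    (hc.stronglyMeasurableAtFilter _ _) hc.continuousAt
  have h2 := (hasDerivAt_exp_smul_const' K t).clm_apply (h1.const_add z₀)
  simp only [mildSolution_eq K z₀ hφ, add_sub_cancel_left]
  refine h2.congr_deriv ?_
  have h3 (x : E) : NormedSpace.exp (t • K) (NormedSpace.exp (-t • K) x) = x :=
    DFunLike.congr_fun (exp_smul_mul_neg K t) x
  rw [h3, map_add K, add_comm]
  rfl

theorem continuous_mildSolution (K : E →L[ℝ] E) (z₀ : E) {φ : ℝ → E} (hφ : Continuous φ) :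
    Continuous (mildSolution K z₀ φ) := by
  have h : Continuous fun s => mildSolution K z₀ φ s - φ s :=
    continuous_iff_continuousAt.2 fun t => (hasDerivAt_mildSolution_sub K z₀ hφ t).continuousAt
  exact (h.add hφ).congr fun t => sub_add_cancel _ _

theorem mildSolution_eq_add_integral (K : E →L[ℝ] E) (z₀ : E) {φ : ℝ → E} (hφ : Continuous φ)
    (t : ℝ) : mildSolution K z₀ φ t =
      z₀ + (∫ s in (0 : ℝ)..t, K (mildSolution K z₀ φ s)) + φ t := by
  have h := intervalIntegral.integral_eq_sub_of_hasDerivAt (a := 0) (b := t)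
    (fun s _ => hasDerivAt_mildSolution_sub K z₀ hφ s)
    ((K.continuous.comp (continuous_mildSolution K z₀ hφ)).intervalIntegrable 0 t)
  have h0 : mildSolution K z₀ φ 0 = z₀ + φ 0 := by
    simp [mildSolution, NormedSpace.exp_zero]
  change ∫ s in (0 : ℝ)..t, K (mildSolution K z₀ φ s) = _ at h
  rw [h, h0]
  abel

theorem hasDerivAt_exp_sub_smul (K : E →L[ℝ] E) (t s : ℝ) :
    HasDerivAt (fun s : ℝ => NormedSpace.exp ((t - s) • K))
      (-(NormedSpace.exp ((t - s) • K) * K)) s :=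
  ((hasDerivAt_exp_smul_const K (t - s)).scomp s ((hasDerivAt_id s).const_sub t)).congr_deriv
    (by simp)

theorem continuous_exp_sub_smul (K : E →L[ℝ] E) (t : ℝ) :
    Continuous fun s : ℝ => NormedSpace.exp ((t - s) • K) :=
  (continuous_exp_smul K).comp (continuous_const.sub continuous_id)

end LinearEquation

/-- Identifies the integral of `e^{(t-s)K}` against `dφ`, as produced by partial integration, with
the forcing term of `mildSolution`. -/
theorem exp_boundary_sub_integral {E : Type*} [NormedAddCommGroup E] [NormedSpace ℝ E]
    (K : E →L[ℝ] E) {φ : ℝ → E} (h0 : φ 0 = 0) (t : ℝ) :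
    NormedSpace.exp ((t - t) • K) (φ t) - NormedSpace.exp ((t - 0) • K) (φ 0) -
        ∫ s in (0 : ℝ)..t, (-(NormedSpace.exp ((t - s) • K) * K)) (φ s) =
      φ t + ∫ s in (0 : ℝ)..t, NormedSpace.exp ((t - s) • K) (K (φ s)) := by
  rw [h0, map_zero, sub_self, zero_smul, NormedSpace.exp_zero, one_apply_eq_self, sub_zero]
  simp only [neg_apply, mul_apply_eq_comp]
  rw [intervalIntegral.integral_neg, sub_neg_eq_add]

section Adapted

variable {Ω : Type*} {m m₀ : MeasurableSpace Ω} {μ : Measure[m₀] Ω}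
  {E : Type*} [NormedAddCommGroup E] [NormedSpace ℝ E] [CompleteSpace E]

/-- The forcing term is a limit of Riemann–Stieltjes sums that use `W` only at times up to `t`,
which gives adaptedness. -/
theorem aestronglyMeasurable_mildSolution (K : E →L[ℝ] E) {Z₀ : Ω → E}
    (hZ₀ : AEStronglyMeasurable[m] Z₀ μ) {W : ℝ≥0 → Ω → E} (hWc : ∀ ω, Continuous fun t => W t ω)
    (hW0 : ∀ ω, W 0 ω = 0) {t : ℝ≥0} (hW : ∀ s ≤ t, AEStronglyMeasurable[m] (W s) μ) :
    AEStronglyMeasurable[m]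
      (fun ω => mildSolution K (Z₀ ω) (fun s => W s.toNNReal ω) t) μ := by
  refine ((NormedSpace.exp ((t : ℝ) • K) : E →L[ℝ] E).continuous.comp_aestronglyMeasurable
    hZ₀).add ?_
  -- Equal subdivision into `n + 1` parts; the minimum keeps all further indices at `t`.
  let τ : ℕ → ℕ → ℝ≥0 := fun n i => min (t * (i / (n + 1 : ℕ))) t
  have hτ (n i : ℕ) : τ n i ≤ t := min_le_right _ _
  refine aestronglyMeasurable_of_ae_tendsto (m := m) (f := fun n ω =>
    ∑ i ∈ Finset.range (n + 1), (NormedSpace.exp (((t : ℝ) - (τ n i : ℝ)) • K) : E →L[ℝ] E)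
      (W (τ n (i + 1)) ω - W (τ n i) ω)) (fun n => ?_) (Eventually.of_forall fun ω => ?_)
  · exact aestronglyMeasurable_finset_sum _ fun i _ =>
      (NormedSpace.exp (((t : ℝ) - (τ n i : ℝ)) • K) : E →L[ℝ] E).continuous.comp_aestronglyMeasurable
        ((hW _ (hτ _ _)).sub (hW _ (hτ _ _)))
  · have h := tendsto_sum_apply_increment (hasDerivAt_exp_sub_smul K t)
      ((continuous_exp_sub_smul K t).mul continuous_const).neg
      (φ := fun s : ℝ => W s.toNNReal ω) ((hWc ω).comp continuous_real_toNNReal) (t := t)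
      (N := fun n => n + 1) (τ := fun n i => (τ n i : ℝ)) (fun n i j hij => ?_) (fun n => ?_)
      (fun n => ?_) (fun ε hε => ?_)
    · rw [exp_boundary_sub_integral K (φ := fun s : ℝ => W s.toNNReal ω) (by simpa using hW0 ω)] at h
      simpa only [Real.toNNReal_coe] using h
    · refine NNReal.coe_le_coe.2 (min_le_min_right _ ?_)
      gcongr
    · simp [τ]
    · have : ((n + 1 : ℕ) : ℝ≥0) ≠ 0 := by positivity
      simp only [τ]
      rw [div_self this, mul_one, min_self]
    · have h1 : Tendsto (fun n : ℕ => (t : ℝ) * (1 / (n + 1 : ℕ))) atTop (𝓝 0) := by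
        have := (tendsto_one_div_add_atTop_nhds_zero_nat (𝕜 := ℝ)).const_mul (t : ℝ)
        simpa using this
      filter_upwards [h1.eventually_lt_const hε] with n hn i hi
      have h2 (k : ℕ) (hk : k ≤ n + 1) : (τ n k : ℝ) = t * (k / (n + 1 : ℕ)) := by
        have : (t : ℝ≥0) * (k / (n + 1 : ℕ)) ≤ t := by
          refine mul_le_of_le_one_right' ?_
          rw [div_le_one (by positivity)]
          exact_mod_cast hk
        simp only [τ]
        rw [min_eq_left this]
        push_cast
        rfl
      rw [h2 i hi.le, h2 (i + 1) hi, ← mul_sub, ← sub_div]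
      push_cast at hn ⊢
      simpa using hn

end Adapted

/-! ### The spectral form of the mild solution -/

section SpectralForm

variable {L : ℕ} {β ρ : ℝ} {w : Weight} {𝒦 : L2 w →L[ℝ] L2 w}

theorem L2.norm_sum_smul_single_le (x : L2 w) (s : Finset ℕ+) :
    ‖∑ j ∈ s, x j • L2.single w j‖ ≤ ‖x‖ := by
  refine le_of_sq_le_sq ?_ (norm_nonneg _)
  have h (k : ℕ) : (∑ j ∈ s, x j • L2.single w j) (k + 1) =
      if k.succPNat ∈ s then x (k + 1) else 0 := by
    rw [← L2.coord_apply, map_sum]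
    simp only [map_smul, L2.coord_apply, L2.single_coe, smul_eq_mul, Pi.single_apply, mul_ite,
      mul_one, mul_zero]
    have h1 (j : ℕ+) : k + 1 = (j : ℕ) ↔ k.succPNat = j := by
      rw [← PNat.coe_inj, Nat.succPNat_coe]
    simp only [h1, Finset.sum_ite_eq]
    rfl
  rw [← (L2.hasSum_norm_sq _).tsum_eq, ← (L2.hasSum_norm_sq x).tsum_eq]
  refine (L2.hasSum_norm_sq _).summable.tsum_le_tsum (fun k => ?_) (L2.hasSum_norm_sq x).summable
  have hw : 0 < w (k + 1) := w.pos _ (by omega)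
  rw [h]
  split_ifs
  · exact le_rfl
  · rw [zero_pow two_ne_zero, zero_div]
    positivity

/-- Dominated convergence along finite sets of coordinates: finite sections do not increase the norm
of `φ s`, so one constant dominates all partial sums on the interval. -/
theorem hasSum_integral_apply {A : ℝ → L2 w →L[ℝ] L2 w} (hA : Continuous A) {φ : ℝ → L2 w}
    (hφ : Continuous φ) (t : ℝ) (i : ℕ) :
    HasSum (fun j : ℕ+ => ∫ s in (0 : ℝ)..t, A s (L2.single w j) i * φ s j)
      ((∫ s in (0 : ℝ)..t, A s (φ s)) i) := by
  have hcA : Continuous fun s => A s (φ s) := hA.clm_apply hφ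
  obtain ⟨C, hC⟩ := (isCompact_uIcc (a := 0) (b := t)).exists_bound_of_continuousOn
    (f := fun s => ‖L2.coord w i ∘L A s‖ * ‖φ s‖)
    ((continuous_const.clm_comp hA).norm.mul hφ.norm).continuousOn
  have hcj (j : ℕ+) : Continuous fun s => A s (L2.single w j) i * φ s j := by
    have h1 : Continuous fun s => L2.coord w i (A s (L2.single w j)) * L2.coord w j (φ s) :=
      ((L2.coord w i).continuous.comp (hA.clm_apply continuous_const)).mul
        ((L2.coord w j).continuous.comp hφ)
    simpa only [L2.coord_apply] using h1
  have hsum (F : Finset ℕ+) (s : ℝ) : ∑ j ∈ F, A s (L2.single w j) i * φ s j =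
      (L2.coord w i ∘L A s) (∑ j ∈ F, φ s j • L2.single w j) := by
    rw [map_sum]
    refine Finset.sum_congr rfl fun j _ => ?_
    rw [map_smul, smul_eq_mul, mul_comm, ContinuousLinearMap.comp_apply, L2.coord_apply]
  rw [← L2.coord_apply, ← ContinuousLinearMap.intervalIntegral_comp_comm _
    (hcA.intervalIntegrable 0 t)]
  simp only [L2.coord_apply]
  have h := intervalIntegral.tendsto_integral_filter_of_dominated_convergence (μ := volume)
    (a := 0) (b := t) (l := (atTop : Filter (Finset ℕ+))) (fun _ => C)
    (F := fun F s => ∑ j ∈ F, A s (L2.single w j) i * φ s j) (f := fun s => A s (φ s) i)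
    (Eventually.of_forall fun F =>
      (continuous_finsetSum F fun j _ => hcj j).aestronglyMeasurable)
    (Eventually.of_forall fun F => Eventually.of_forall fun s hs => ?_)
    intervalIntegrable_const
    (Eventually.of_forall fun s _ => L2.hasSum_apply (φ s) (A s) i)
  · refine h.congr fun F => ?_
    exact intervalIntegral.integral_finsetSum fun j _ => (hcj j).intervalIntegrable 0 t
  · rw [hsum]
    have h2 := hC s (Set.uIoc_subset_uIcc hs)
    rw [Real.norm_of_nonneg (by positivity)] at h2
    refine ((L2.coord w i ∘L A s).le_opNorm _).trans (le_trans ?_ h2)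
    gcongr
    exact L2.norm_sum_smul_single_le _ _

/-- The process `x ↦ ∫_0^t e^{xs} db(s)` for a continuous path `b`, after partial integration. -/
def expIntegral (b : ℝ → ℝ) (t x : ℝ) : ℝ :=
  Real.exp (x * t) * b t - Real.exp (x * 0) * b 0 - ∫ s in (0 : ℝ)..t, x * Real.exp (x * s) * b s

theorem continuous_expIntegral {b : ℝ → ℝ} (hb : Continuous b) (t : ℝ) :
    Continuous (expIntegral b t) := by
  unfold expIntegral
  have h : Continuous fun x : ℝ => ∫ s in (0 : ℝ)..t, x * Real.exp (x * s) * b s :=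
    intervalIntegral.continuous_parametric_intervalIntegral_of_continuous' (by fun_prop) 0 t
  fun_prop

theorem integral_integral_swap_of_ae_mem_Icc {ψ : Measure ℝ} [IsFiniteMeasure ψ] {M : ℝ}
    (hM : ∀ᵐ x ∂ψ, x ∈ Set.Icc 0 M) {f : ℝ → ℝ → ℝ} (hf : Continuous (Function.uncurry f)) {t : ℝ}
    (ht : 0 ≤ t) :
    ∫ x, (∫ s in (0 : ℝ)..t, f x s) ∂ψ = ∫ s in (0 : ℝ)..t, ∫ x, f x s ∂ψ := by
  simp only [intervalIntegral.integral_of_le ht]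
  refine integral_integral_swap ?_
  rw [← Measure.restrict_eq_self_of_ae_mem hM, Measure.prod_restrict]
  refine (hf.continuousOn.integrableOn_compact
    ((isCompact_Icc (a := 0) (b := M)).prod (isCompact_Icc (a := 0) (b := t)))).mono_set ?_
  exact Set.prod_mono le_rfl Set.Ioc_subset_Icc_self

/-- After multiplication by `e^{-xt}` the boundary term becomes `b(t)`, and orthogonality yields the
Kronecker delta. The remaining kernel `-x e^{-x(t-s)}` represents the matrix of `e^{(t-s)𝒦} 𝒦`,
after exchanging the two integrals. -/
theorem integral_mul_expIntegral (hL : 1 ≤ L) (hρ0 : 0 < ρ) (hβ : 0 < β) {ψ : Measure ℝ}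
    (hψ : IsSpectralMeasure L β ρ ψ) {M : ℝ} (hM : ∀ᵐ x ∂ψ, x ∈ Set.Icc 0 M)
    (h𝒦 : ∀ (x : L2 w) (k : ℕ), 𝒦 x k = drift L β ρ x k) {b : ℝ → ℝ} (hb : Continuous b)
    (hb0 : b 0 = 0) {t : ℝ} (ht : 0 ≤ t) (j i : ℕ+) :
    potential L ρ i * ∫ x, Real.exp (-(x * t)) * (orthoPoly L β ρ i).eval x *
      (orthoPoly L β ρ j).eval x * expIntegral b t x ∂ψ =
    (if i = j then b t else 0) +
      ∫ s in (0 : ℝ)..t, NormedSpace.exp ((t - s) • 𝒦) (𝒦 (L2.single w j)) i * b s := by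
  have := hψ.isProbabilityMeasure
  set Q : ℝ → ℝ := fun x => (orthoPoly L β ρ i).eval x * (orthoPoly L β ρ j).eval x with hQ
  have hQc : Continuous Q := by fun_prop
  have hf : Continuous (Function.uncurry fun x s : ℝ =>
      -x * (Real.exp (-(x * (t - s))) * (orthoPoly L β ρ i).eval x *
        (orthoPoly L β ρ j).eval x) * b s) := by
    have h1 : Continuous fun p : ℝ × ℝ => (orthoPoly L β ρ i).eval p.1 :=
      (orthoPoly L β ρ i).continuous.comp continuous_fst
    have h2 : Continuous fun p : ℝ × ℝ => (orthoPoly L β ρ j).eval p.1 :=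
      (orthoPoly L β ρ j).continuous.comp continuous_fst
    unfold Function.uncurry
    fun_prop
  have hpoint (x : ℝ) : Real.exp (-(x * t)) * (orthoPoly L β ρ i).eval x *
      (orthoPoly L β ρ j).eval x * expIntegral b t x = b t * Q x +
      ∫ s in (0 : ℝ)..t, -x * (Real.exp (-(x * (t - s))) * (orthoPoly L β ρ i).eval x *
        (orthoPoly L β ρ j).eval x) * b s := by
    have h1 : ∫ s in (0 : ℝ)..t, -x * (Real.exp (-(x * (t - s))) * (orthoPoly L β ρ i).eval x *
        (orthoPoly L β ρ j).eval x) * b s =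
        -(Real.exp (-(x * t)) * Q x) * ∫ s in (0 : ℝ)..t, x * Real.exp (x * s) * b s := by
      rw [← intervalIntegral.integral_const_mul]
      refine intervalIntegral.integral_congr fun s _ => ?_
      have h2 : Real.exp (-(x * (t - s))) = Real.exp (-(x * t)) * Real.exp (x * s) := by
        rw [← Real.exp_add]
        ring_nf
      simp only [h2, hQ]
      ring
    have h3 : Real.exp (-(x * t)) * Real.exp (x * t) = 1 := by
      rw [← Real.exp_add, neg_add_cancel, Real.exp_zero]
    rw [h1, expIntegral, hb0]
    linear_combination (b t * Q x) * h3
  have hc2 : Continuous fun x : ℝ => ∫ s in (0 : ℝ)..t, -x * (Real.exp (-(x * (t - s))) *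
      (orthoPoly L β ρ i).eval x * (orthoPoly L β ρ j).eval x) * b s :=
    intervalIntegral.continuous_parametric_intervalIntegral_of_continuous' hf 0 t
  simp only [hpoint]
  rw [integral_add (integrable_of_ae_mem_Icc hM (by fun_prop)) (integrable_of_ae_mem_Icc hM hc2),
    integral_const_mul, hψ.orthogonal _ _ i.pos j.pos,
    integral_integral_swap_of_ae_mem_Icc hM hf ht, mul_add, ← intervalIntegral.integral_const_mul]
  congr 1
  · have := (potential_pos (L := L) hL hρ0 i).ne'
    simp only [PNat.coe_inj]
    split_ifs
    · field_simp
    · ring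
  · refine intervalIntegral.integral_congr fun s _ => ?_
    have h := exp_pow_single_apply hL hρ0 hβ hψ hM h𝒦 (t - s) 1 j i
    simp only [pow_one] at h
    rw [h, integral_mul_const]
    ring

theorem hasSum_spectral_mildSolution (hL : 1 ≤ L) (hρ0 : 0 < ρ) (hβ : 0 < β) {ψ : Measure ℝ}
    (hψ : IsSpectralMeasure L β ρ ψ) {M : ℝ} (hM : ∀ᵐ x ∂ψ, x ∈ Set.Icc 0 M)
    (h𝒦 : ∀ (x : L2 w) (k : ℕ), 𝒦 x k = drift L β ρ x k) (z₀ : L2 w) {φ : ℝ → L2 w}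
    (hφ : Continuous φ) (hφ0 : φ 0 = 0) {t : ℝ} (ht : 0 ≤ t) (i : ℕ+) :
    HasSum (fun j : ℕ+ => potential L ρ i * ∫ x, Real.exp (-(x * t)) *
      (orthoPoly L β ρ i).eval x * (orthoPoly L β ρ j).eval x *
        (z₀ j + expIntegral (fun s => φ s j) t x) ∂ψ) (mildSolution 𝒦 z₀ φ t i) := by
  have := hψ.isProbabilityMeasure
  have hφj (j : ℕ+) : Continuous fun s => φ s j := by
    simpa only [Function.comp_def, L2.coord_apply] using (L2.coord w j).continuous.comp hφ
  have h1 := hasSum_transition h𝒦 t z₀ i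
  have h2 : HasSum (fun j : ℕ+ => if i = j then φ t j else 0) (φ t i) := by
    have h := hasSum_ite_eq i (φ t i)
    refine h.congr_fun fun j => ?_
    by_cases hij : i = j
    · subst hij
      simp
    · rw [if_neg hij, if_neg (Ne.symm hij)]
  have h3 := hasSum_integral_apply (A := fun s => NormedSpace.exp ((t - s) • 𝒦) * 𝒦)
    ((continuous_exp_sub_smul 𝒦 t).mul continuous_const) hφ t i
  refine (h1.add (h2.add h3)).congr_fun fun j => ?_
  have h4 := integral_mul_expIntegral hL hρ0 hβ hψ hM h𝒦 (hφj j) (by rw [hφ0]; rfl) ht j i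
  have h5 := continuous_expIntegral (hφj j) t
  simp only [mul_add]
  rw [integral_add (integrable_of_ae_mem_Icc hM (by fun_prop))
    (integrable_of_ae_mem_Icc hM (by fun_prop)), mul_add, h4, integral_mul_const,
    transition_eq_integral hL hρ0 hβ hψ hM h𝒦 t j i, mul_assoc]
  rfl

end SpectralForm

/-! ### The stochastic equation -/

section SDE

variable {L : ℕ} {β ρ : ℝ} {w : Weight} {𝒦 : L2 w →L[ℝ] L2 w} {Ω : Type*} [MeasurableSpace Ω]
  {μ : Measure Ω} {B : ℕ → ℝ≥0 → Ω → ℝ}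

/-- The noise cancels in each coordinate of the difference, so uniqueness holds even if `B` does not
live in `L₂(w)`. Boundedness of `𝒦` assembles the coordinate equations into a Bochner integral
equation. -/
theorem IsSDESolution.ae_eq (h𝒦 : ∀ (x : L2 w) (k : ℕ), 𝒦 x k = drift L β ρ x k)
    {Z Z' : ℝ≥0 → Ω → L2 w} (hZ : IsSDESolution L β ρ μ B Z) (hZ' : IsSDESolution L β ρ μ B Z')
    (h0 : Z 0 =ᵐ[μ] Z' 0) : ∀ᵐ ω ∂μ, ∀ t, Z t ω = Z' t ω := by
  filter_upwards [hZ.integrable, hZ'.integrable, hZ.equation, hZ'.equation, h0]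
    with ω hi hi' he he' h0 t
  have hcoord {z : ℝ≥0 → L2 w}
      (hz : ∀ T : ℝ≥0, IntervalIntegrable (fun s : ℝ => z s.toNNReal) volume 0 T) (t : ℝ≥0) (k : ℕ) :
      IntervalIntegrable (fun s : ℝ => drift L β ρ (z s.toNNReal) k) volume 0 t := by
    have h : IntervalIntegrable (fun s : ℝ => (L2.coord w k ∘L 𝒦) (z s.toNNReal)) volume 0 t :=
      ⟨(L2.coord w k ∘L 𝒦).integrable_comp (hz t).1, (L2.coord w k ∘L 𝒦).integrable_comp (hz t).2⟩
    simpa only [ContinuousLinearMap.comp_apply, L2.coord_apply, h𝒦] using h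
  have hsub (T : ℝ≥0) :
      IntervalIntegrable (fun s : ℝ => Z s.toNNReal ω - Z' s.toNNReal ω) volume 0 T :=
    (hi T).sub (hi' T)
  refine sub_eq_zero.1 (eq_zero_of_eq_integral 𝒦 (z := fun t => Z t ω - Z' t ω) hsub
    (fun t => L2.ext fun k => ?_) t)
  have hK : IntervalIntegrable (fun s : ℝ => 𝒦 (Z s.toNNReal ω - Z' s.toNNReal ω)) volume 0 t :=
    ⟨𝒦.integrable_comp (hsub t).1, 𝒦.integrable_comp (hsub t).2⟩
  rw [← L2.coord_apply (∫ s in (0 : ℝ)..t, 𝒦 (Z s.toNNReal ω - Z' s.toNNReal ω)),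
    ← ContinuousLinearMap.intervalIntegral_comp_comm _ hK]
  simp only [map_sub, L2.coord_apply, h𝒦]
  rw [intervalIntegral.integral_sub (hcoord (z := fun t => Z t ω) hi t k)
    (hcoord (z := fun t => Z' t ω) hi' t k), L2.sub_apply, he t k k.pos, he' t k k.pos, h0]
  ring

theorem IsDrivingNoise.aemeasurable (hL : 1 ≤ L) (hρ0 : 0 < ρ) (hρ1 : ρ < 1) (hβ : 0 < β)
    (hB : IsDrivingNoise L β ρ μ B) (k : ℕ) (t : ℝ≥0) : AEMeasurable (B k t) μ := by
  rcases Nat.eq_zero_or_pos k with rfl | hk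
  · have : B 0 t = fun _ => 0 := funext (hB.zero t)
    rw [this]
    exact aemeasurable_const
  · have h := ((hB.brownian k hk).aemeasurable t).mul_const √(noiseVar L β ρ k)
    refine h.congr (Eventually.of_forall fun ω => ?_)
    exact div_mul_cancel₀ _ (Real.sqrt_pos.2 (noiseVar_pos hL hρ0 hρ1 hβ k)).ne'

theorem aestronglyMeasurable_noiseSigma_initial (Z₀ : Ω → L2 w) (t : ℝ≥0) :
    AEStronglyMeasurable[noiseSigma Z₀ B t] Z₀ μ := by
  refine L2.aestronglyMeasurable_of_apply (m := noiseSigma Z₀ B t) (c := fun k ω => Z₀ ω k)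
    (fun k => ?_) (Eventually.of_forall fun ω k => rfl)
  have h : Measurable[noiseSigma Z₀ B t] fun ω => Z₀ ω k :=
    (comap_measurable _).mono
      ((le_iSup (fun k : ℕ => MeasurableSpace.comap (fun ω => Z₀ ω k) (borel ℝ)) k).trans
        le_sup_left) le_rfl
  exact ⟨_, h.stronglyMeasurable, EventuallyEq.rfl⟩

theorem aestronglyMeasurable_noiseSigma_noise (Z₀ : Ω → L2 w) {W : ℝ≥0 → Ω → L2 w}
    (hW : ∀ᵐ ω ∂μ, ∀ t k, W t ω k = B k t ω) {s t : ℝ≥0} (hst : s ≤ t) :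
    AEStronglyMeasurable[noiseSigma Z₀ B t] (W s) μ := by
  refine L2.aestronglyMeasurable_of_apply (m := noiseSigma Z₀ B t) (c := fun k ω => B k s ω)
    (fun k => ?_) (hW.mono fun ω h k => h s k)
  have h : Measurable[noiseSigma Z₀ B t] fun ω => B k s ω := by
    refine (comap_measurable (B k s)).mono (le_trans ?_ le_sup_right) le_rfl
    exact le_iSup_of_le (k : ℕ) (le_iSup_of_le s (le_iSup_of_le hst le_rfl))
  exact ⟨_, h.stronglyMeasurable, EventuallyEq.rfl⟩

theorem isSDESolution_mildSolution (h𝒦 : ∀ (x : L2 w) (k : ℕ), 𝒦 x k = drift L β ρ x k)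
    {Z₀ : Ω → L2 w} (hZ₀ : AEStronglyMeasurable Z₀ μ) {W : ℝ≥0 → Ω → L2 w}
    (hWm : ∀ t, AEStronglyMeasurable (W t) μ) (hWc : ∀ ω, Continuous fun t => W t ω)
    (hW0 : ∀ ω, W 0 ω = 0) (hWB : ∀ᵐ ω ∂μ, ∀ t k, W t ω k = B k t ω) :
    IsSDESolution L β ρ μ B
      (fun t ω => mildSolution 𝒦 (Z₀ ω) (fun s => W s.toNNReal ω) t) where
  aestronglyMeasurable t := aestronglyMeasurable_mildSolution 𝒦 hZ₀ hWc hW0 fun s _ => hWm s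
  integrable := Eventually.of_forall fun ω T =>
    ((continuous_mildSolution 𝒦 (Z₀ ω) ((hWc ω).comp continuous_real_toNNReal)).comp
      (NNReal.continuous_coe.comp continuous_real_toNNReal)).intervalIntegrable 0 T
  equation := by
    filter_upwards [hWB] with ω hω t k _
    set φ : ℝ → L2 w := fun s => W s.toNNReal ω with hφ
    have hφc : Continuous φ := (hWc ω).comp continuous_real_toNNReal
    have hKc : Continuous fun s => 𝒦 (mildSolution 𝒦 (Z₀ ω) φ s) :=
      𝒦.continuous.comp (continuous_mildSolution 𝒦 (Z₀ ω) hφc)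
    have h0 : mildSolution 𝒦 (Z₀ ω) φ 0 = Z₀ ω := by
      simp [mildSolution, NormedSpace.exp_zero, hφ, hW0]
    have hint : ∫ s in (0 : ℝ)..t, drift L β ρ (mildSolution 𝒦 (Z₀ ω) φ (s.toNNReal : ℝ) : L2 w) k =
        (∫ s in (0 : ℝ)..t, 𝒦 (mildSolution 𝒦 (Z₀ ω) φ s)) k := by
      rw [← L2.coord_apply (∫ s in (0 : ℝ)..t, 𝒦 (mildSolution 𝒦 (Z₀ ω) φ s)),
        ← ContinuousLinearMap.intervalIntegral_comp_comm _ (hKc.intervalIntegrable 0 t)]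
      refine intervalIntegral.integral_congr fun s hs => ?_
      rw [Set.uIcc_of_le t.coe_nonneg] at hs
      rw [L2.coord_apply, h𝒦, Real.coe_toNNReal _ hs.1]
    rw [hint, NNReal.coe_zero, h0, ← hω t k]
    have h := congrArg (fun x : L2 w => x k) (mildSolution_eq_add_integral 𝒦 (Z₀ ω) hφc t)
    simp only [L2.add_apply] at h
    rw [h]
    simp only [hφ, Real.toNNReal_coe]

theorem isStochasticIntegral_expIntegral [IsFiniteMeasure μ] {b : ℝ≥0 → Ω → ℝ}
    (hb : ∀ t, AEMeasurable (b t) μ) (hbc : ∀ᵐ ω ∂μ, Continuous fun t => b t ω) (t : ℝ≥0) (x : ℝ) :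
    IsStochasticIntegral μ (fun s : ℝ≥0 => Real.exp (x * s) • ContinuousLinearMap.id ℝ ℝ) b t
      (fun ω => expIntegral (fun s => b s.toNNReal ω) t x) := by
  have h := isStochasticIntegral_of_hasDerivAt (μ := μ)
    (Φ := fun s : ℝ => Real.exp (x * s) • ContinuousLinearMap.id ℝ ℝ)
    (Φ' := fun s : ℝ => (x * Real.exp (x * s)) • ContinuousLinearMap.id ℝ ℝ)
    (fun s => by
      have h1 : HasDerivAt (fun s : ℝ => Real.exp (x * s)) (x * Real.exp (x * s)) s := by
        have := ((hasDerivAt_id s).const_mul x).exp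
        exact this.congr_deriv (by simp [mul_comm])
      exact h1.smul_const (ContinuousLinearMap.id ℝ ℝ))
    (by fun_prop) (fun s => (hb s).aestronglyMeasurable) hbc t
  simpa [expIntegral] using h

end SDE

end EquilibriumOU

end

/-! ### Assembly: one transition matrix and one spectral measure for all weights -/

theorem theorem2p6 (α β ρ : ℝ) (L : ℕ) (hα : 0 < α) (hαβ : α < β) (hρ : ρ = α / β) (hL : 1 ≤ L) :
    ∃ (ψ : Measure ℝ) (P : ℝ → ℕ+ → ℕ+ → ℝ),
      IsSpectralMeasure L β ρ ψ ∧
      IsTransitionFunction (generator L β ρ) P ∧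
      (∀ t : ℝ, 0 ≤ t → ∀ i j : ℕ+, P t j i = potential L ρ i *
        ∫ x, Real.exp (-(x * t)) * (orthoPoly L β ρ i).eval x * (orthoPoly L β ρ j).eval x ∂ψ) ∧
      -- the conclusions for a general weight
      (∀ w : Weight, WeightCondition L ρ w →
        -- boundedness of the drift operator
        ∃ 𝒦 : L2 w →L[ℝ] L2 w, (∀ (x : L2 w) (k : ℕ), 𝒦 x k = drift L β ρ x k) ∧
        -- existence and uniqueness for the linear equation
        (∀ z₀ : L2 w,
          (∀ t : ℝ, 0 ≤ t → HasDerivWithinAt (fun s : ℝ => NormedSpace.exp (s • 𝒦) z₀)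
            (𝒦 (NormedSpace.exp (t • 𝒦) z₀)) (Set.Ici 0) t) ∧
          ∀ z : ℝ → L2 w, z 0 = z₀ →
            (∀ t : ℝ, 0 ≤ t → HasDerivWithinAt z (𝒦 (z t)) (Set.Ici 0) t) →
            ∀ t : ℝ, 0 ≤ t → z t = NormedSpace.exp (t • 𝒦) z₀) ∧
        -- the matrix of the exponential is the transpose of the transition matrix
        (∀ t : ℝ, 0 ≤ t → ∀ (x : L2 w) (i : ℕ+),
          HasSum (fun j : ℕ+ => P t j i * x j) (NormedSpace.exp (t • 𝒦) x i)) ∧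
        -- pathwise uniqueness for the SDE
        (∀ (Ω : Type*) [MeasurableSpace Ω] (μ : Measure Ω) [IsProbabilityMeasure μ]
          (B : ℕ → ℝ≥0 → Ω → ℝ), IsDrivingNoise L β ρ μ B →
          ∀ Z Z' : ℝ≥0 → Ω → L2 w, IsSDESolution L β ρ μ B Z → IsSDESolution L β ρ μ B Z' →
            Z 0 =ᵐ[μ] Z' 0 → ∀ᵐ ω ∂μ, ∀ t, Z t ω = Z' t ω) ∧
        -- existence and explicit form of the solution of the SDE
        (StablePointSummable L ρ w →
          ∀ (Ω : Type*) [MeasurableSpace Ω] (μ : Measure Ω) [IsProbabilityMeasure μ]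
          (B : ℕ → ℝ≥0 → Ω → ℝ), IsDrivingNoise L β ρ μ B →
          ∀ Z₀ : Ω → L2 w, AEStronglyMeasurable Z₀ μ →
          ∃ (W : ℝ≥0 → Ω → L2 w) (Z : ℝ≥0 → Ω → L2 w),
            -- the noise as a continuous process in the weighted space
            (∀ᵐ ω ∂μ, Continuous (fun t => W t ω) ∧ ∀ t k, W t ω k = B k t ω) ∧
            IsSDESolution L β ρ μ B Z ∧ Z 0 =ᵐ[μ] Z₀ ∧
            (∀ᵐ ω ∂μ, Continuous (fun t => Z t ω)) ∧
            (∀ t, AEStronglyMeasurable[noiseSigma Z₀ B t] (Z t) μ) ∧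
            (∀ Z' : ℝ≥0 → Ω → L2 w, IsSDESolution L β ρ μ B Z' → Z' 0 =ᵐ[μ] Z₀ →
              ∀ᵐ ω ∂μ, ∀ t, Z' t ω = Z t ω) ∧
            (∀ t : ℝ≥0, ∃ I : Ω → L2 w,
              IsStochasticIntegral μ
                (fun s : ℝ≥0 => NormedSpace.exp (((t : ℝ) - (s : ℝ)) • 𝒦)) W t I ∧
              Z t =ᵐ[μ] fun ω => NormedSpace.exp ((t : ℝ) • 𝒦) (Z₀ ω) + I ω) ∧
            -- the spectral form of the solution
            (∀ t : ℝ≥0, ∃ J : ℕ → ℝ → Ω → ℝ,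
              (∀ j, 1 ≤ j → ∀ x : ℝ, IsStochasticIntegral μ
                (fun s : ℝ≥0 => Real.exp (x * s) • ContinuousLinearMap.id ℝ ℝ)
                (B j) t (J j x)) ∧
              ∀ᵐ ω ∂μ, (∀ j, 1 ≤ j → Continuous (fun x => J j x ω)) ∧
                ∀ i : ℕ+,
                  (∀ j : ℕ+, Integrable (fun x => Real.exp (-(x * t)) *
                    (orthoPoly L β ρ i).eval x * (orthoPoly L β ρ j).eval x *
                      (Z₀ ω j + J j x ω)) ψ) ∧
                  HasSum (fun j : ℕ+ => potential L ρ i * ∫ x, Real.exp (-(x * t)) *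
                    (orthoPoly L β ρ i).eval x * (orthoPoly L β ρ j).eval x *
                      (Z₀ ω j + J j x ω) ∂ψ) (Z t ω i)))) ∧
      -- the weights of interest
      (∀ hρ' : 0 < ρ, WeightCondition L ρ (potentialWeight L ρ hL hρ') ∧
        (2 ≤ L → StablePointSummable L ρ (potentialWeight L ρ hL hρ'))) ∧
      (∀ (θ : ℝ) (hθ : 0 < θ), WeightCondition L ρ (geometricWeight θ hθ) ∧
        (2 ≤ L → StablePointSummable L ρ (geometricWeight θ hθ)) ∧
        (L = 1 → ρ < θ → StablePointSummable L ρ (geometricWeight θ hθ))) := by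
  have hβ : 0 < β := hα.trans hαβ
  have hρ0 : 0 < ρ := hρ ▸ div_pos hα hβ
  have hρ1 : ρ < 1 := hρ ▸ (div_lt_one hβ).2 hαβ
  obtain ⟨ψ, hψ, M, hM⟩ := exists_spectralMeasure hL hρ0 hρ1 hβ
  have := hψ.isProbabilityMeasure
  -- The weight `π` serves only to realize the `w`-independent matrix as the exponential of a
  -- bounded operator.
  obtain ⟨𝒦π, h𝒦π⟩ := exists_driftOperator hρ0 hρ1 hβ (weightCondition_potential hL hρ0 hρ1)
  refine ⟨ψ, transition L β ρ, hψ, isTransitionFunction_transition hρ0 hρ1 hβ h𝒦π,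
    fun t _ i j => transition_eq_integral hL hρ0 hβ hψ hM h𝒦π t j i, fun w hw => ?_,
    fun hρ' => ⟨weightCondition_potential hL hρ' hρ1,
      fun hL2 => stablePointSummable_potential hL hL2 hρ'⟩,
    fun θ hθ => ⟨weightCondition_geometric L hρ0 hρ1 hθ,
      fun hL2 => stablePointSummable_geometric hL2 hρ0 hρ1 hθ,
      fun hL1 h => hL1 ▸ stablePointSummable_geometric_one hρ0 hθ h⟩⟩
  obtain ⟨𝒦, h𝒦⟩ := exists_driftOperator hρ0 hρ1 hβ hw
  refine ⟨𝒦, h𝒦, fun z₀ => ⟨fun t _ => (hasDerivAt_exp_smul_apply 𝒦 z₀ t).hasDerivWithinAt,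
    fun z hz0 hz t ht => hz0 ▸ eq_exp_smul_apply_of_hasDerivWithinAt 𝒦 hz ht⟩,
    fun t _ x i => hasSum_transition h𝒦 t x i,
    fun Ω _ μ _ B _ Z Z' hZ hZ' h0 => hZ.ae_eq h𝒦 hZ' h0, fun hu Ω _ μ _ B hB Z₀ hZ₀ => ?_⟩
  obtain ⟨W, hWc, hW0, hWB⟩ := exists_noise_path hL hρ0 hρ1 hβ hu hB
  have hBm := hB.aemeasurable hL hρ0 hρ1 hβ
  have hWm (t : ℝ≥0) : AEStronglyMeasurable (W t) μ :=
    L2.aestronglyMeasurable_of_apply (c := fun k ω => B k t ω)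
      (fun k => (hBm k t).aestronglyMeasurable) (hWB.mono fun ω h k => h t k)
  have hBc : ∀ᵐ ω ∂μ, ∀ k, Continuous fun t => B k t ω := by
    filter_upwards [hWB] with ω hω k
    have h := (L2.coord w k).continuous.comp (hWc ω)
    simpa only [Function.comp_def, L2.coord_apply, hω] using h
  have hφc (ω : Ω) : Continuous fun s : ℝ => W s.toNNReal ω :=
    (hWc ω).comp continuous_real_toNNReal
  have hφ0 (ω : Ω) : W (0 : ℝ).toNNReal ω = 0 := by simpa using hW0 ω
  have hsol := isSDESolution_mildSolution h𝒦 hZ₀ hWm hWc hW0 hWB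
  have hinit (ω : Ω) : mildSolution 𝒦 (Z₀ ω) (fun s => W s.toNNReal ω) 0 = Z₀ ω := by
    simp [mildSolution, NormedSpace.exp_zero, hW0]
  refine ⟨W, fun t ω => mildSolution 𝒦 (Z₀ ω) (fun s => W s.toNNReal ω) t,
    hWB.mono fun ω h => ⟨hWc ω, h⟩, hsol, Eventually.of_forall hinit,
    Eventually.of_forall fun ω =>
      (continuous_mildSolution 𝒦 (Z₀ ω) (hφc ω)).comp NNReal.continuous_coe,
    fun t => aestronglyMeasurable_mildSolution 𝒦 (aestronglyMeasurable_noiseSigma_initial Z₀ t)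
      hWc hW0 fun s hs => aestronglyMeasurable_noiseSigma_noise Z₀ hWB hs,
    fun Z' hZ' h0 => hZ'.ae_eq h𝒦 hsol (h0.trans (Eventually.of_forall fun ω => (hinit ω).symm)),
    fun t => ⟨_, isStochasticIntegral_of_hasDerivAt (hasDerivAt_exp_sub_smul 𝒦 t)
      ((continuous_exp_sub_smul 𝒦 t).mul continuous_const).neg hWm
      (Eventually.of_forall hWc) t, Eventually.of_forall fun ω => ?_⟩,
    -- Partial integration supplies the version of the integral of `e^{xs}` that is continuous in
    -- `x`.
    fun t => ⟨fun j x ω => expIntegral (fun s => B j s.toNNReal ω) t x,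
      fun j _ x => isStochasticIntegral_expIntegral (hBm j) (hBc.mono fun ω h => h j) t x, ?_⟩⟩
  · have h := exp_boundary_sub_integral 𝒦 (φ := fun s : ℝ => W s.toNNReal ω) (hφ0 ω) t
    simp only [Real.toNNReal_coe, Real.toNNReal_zero] at h
    beta_reduce
    rw [mildSolution, h, Real.toNNReal_coe]
  · filter_upwards [hWB, hBc] with ω hω hc
    have hJ (j : ℕ) : Continuous fun x => expIntegral (fun s => B j s.toNNReal ω) t x :=
      continuous_expIntegral ((hc j).comp continuous_real_toNNReal) t
    refine ⟨fun j _ => hJ j, fun i => ⟨fun j => ?_, ?_⟩⟩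
    · have := hJ j
      exact integrable_of_ae_mem_Icc hM (by fun_prop)
    · have h := hasSum_spectral_mildSolution hL hρ0 hβ hψ hM h𝒦 (Z₀ ω) (hφc ω) (hφ0 ω)
        t.coe_nonneg i
      simpa only [hω] using h
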